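/- Let $N\ge 1$, let $A_k\in\mathbb R^{n\times n}$ be invertible and $B_k\in\mathbb R^{n\times m}$ arbitrary for $k=0,\dots,N-1$, and let $\bar\Sigma_0,\bar\Sigma_N\in\mathbb R^{n\times n}$ be symmetric positive definite. Let $\Phi(k,l)=A_{k-1}\cdots A_l$ for $k>l$, $\Phi(k,k)=I$, $\Phi(k,l)=A_k^{-1}\cdots A_{l-1}^{-1}$ for $k<l$, and for $k_0<k_1$ put $$G_{\rm r}(k_1,k_0)=\sum_{k=k_0}^{k_1-1}\Phi(k_1,k+1)B_kB_k^\top\Phi(k_1,k+1)^\top,\qquad G_{\rm c}(k_1,k_0)=\sum_{k=k_0}^{k_1-1}\Phi(k_0,k+1)B_kB_k^\top\Phi(k_0,k+1)^\top .$$ Assume that there is $k_{\rm r}\in\{1,\dots,N\}$ such that $G_{\rm r}(k,0)$ is invertible for all $k\in\{k_{\rm r},\dots,N\}$ and $G_{\rm r}(N,k)$ is invertible for all $k\in\{0,\dots,k_{\rm r}-1\}$. Write $G_{\rm c}=G_{\rm c}(N,0)$, let $$S_0=G_{\rm c}^{-1/2}\bar\Sigma_0G_{\rm c}^{-1/2},\qquad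 S_N=G_{\rm c}^{-1/2}\Phi(0,N)\bar\Sigma_N\Phi(0,N)^\top G_{\rm c}^{-1/2},$$ and assume that the two matrices $$\mathcal F=S_0+\tfrac12I-\bigl(S_0^{1/2}S_NS_0^{1/2}+\tfrac14I\bigr)^{1/2},\qquad \mathcal B=-S_0+\tfrac12I+\bigl(S_0^{1/2}S_NS_0^{1/2}+\tfrac14I\bigr)^{1/2}$$ are invertible. Let $$Q_{-,0}=G_{\rm c}^{1/2}S_0^{1/2}\mathcal F^{-1}S_0^{1/2}G_{\rm c}^{1/2},\qquad Q_{-,k+1}=A_kQ_{-,k}A_k^\top-B_kB_k^\top,$$ and, with $M_k=I+B_k^\top Q_{-,k+1}^{-1}B_k$, $$A_{Q,k}=A_k-B_kM_k^{-1}B_k^\top Q_{-,k+1}^{-1}A_k,\qquad B_{Q,k}=B_kM_k^{-1/2}.$$ Let $\mathbb P^*$ be the law on $(\mathbb R^n)^{N+1}$ of the process $x^*_{k+1}=A_{Q,k}x^*_k+B_{Q,k}w_k$, and $\widetilde{\mathbb P}$ the law of the process $\tilde x_{k+1}=A_k\tilde x_k+B_kw_k$, where in both cases the initial state is $\mathcal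 N(0,\bar\Sigma_0)$-distributed, $w_0,\dots,w_{N-1}$ are $\mathcal N(0,I)$-distributed, and the initial state and the $w_k$ are independent. (The process $x^*$ is the closed-loop state process of $x_{k+1}=A_kx_k+B_ku_k$ under the Gaussian policy $u_k\sim\mathcal N(-M_k^{-1}B_k^\top Q_{-,k+1}^{-1}A_kx_k,\,M_k^{-1})$.) Then $\mathbb P^*$ is the unique solution of the Schrödinger bridge problem: among all probability measures $\mathbb P$ on $(\mathbb R^n)^{N+1}$ whose marginals at the times $0$ and $N$ are $\mathcal N(0,\bar\Sigma_0)$ and $\mathcal N(0,\bar\Sigma_N)$, the Kullback–Leibler divergence $D_{\rm KL}(\mathbb P\,\|\,\widetilde{\mathbb P})$ is minimized by $\mathbb P^*$ and by no other measure. -/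

import Mathlib

open MeasureTheory ProbabilityTheory InformationTheory
open scoped Matrix MatrixOrder

noncomputable section

/-! ### Transition matrices and Gramians of `x (k+1) = A k x k + B k u k` -/

/-- The product `A (l+d-1) * ⋯ * A (l+1) * A l` of `d` factors. -/
def forwardProd {n : ℕ} (A : ℕ → Matrix (Fin n) (Fin n) ℝ) (l : ℕ) :
    ℕ → Matrix (Fin n) (Fin n) ℝ
  | 0 => 1
  | d + 1 => A (l + d) * forwardProd A l d

/-- The product `(A k)⁻¹ * (A (k+1))⁻¹ * ⋯ * (A (k+d-1))⁻¹` of `d` factors. -/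
def backwardProd {n : ℕ} (A : ℕ → Matrix (Fin n) (Fin n) ℝ) (k : ℕ) :
    ℕ → Matrix (Fin n) (Fin n) ℝ
  | 0 => 1
  | d + 1 => backwardProd A k d * (A (k + d))⁻¹

/-- The state-transition matrix `Φ(k, l)`: `A (k-1) * ⋯ * A l` for `k > l`, the identity for
`k = l`, and `(A k)⁻¹ * ⋯ * (A (l-1))⁻¹` for `k < l`. -/
def transition {n : ℕ} (A : ℕ → Matrix (Fin n) (Fin n) ℝ) (k l : ℕ) :
    Matrix (Fin n) (Fin n) ℝ :=
  if l ≤ k then forwardProd A l (k - l) else backwardProd A k (l - k)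

/-- The reachability Gramian `∑_{k0 ≤ k < k1} Φ(k1, k+1) B_k B_kᵀ Φ(k1, k+1)ᵀ`. -/
def reachGramian {n m : ℕ} (A : ℕ → Matrix (Fin n) (Fin n) ℝ)
    (B : ℕ → Matrix (Fin n) (Fin m) ℝ) (k1 k0 : ℕ) : Matrix (Fin n) (Fin n) ℝ :=
  ∑ k ∈ Finset.Ico k0 k1,
    transition A k1 (k + 1) * B k * (B k)ᵀ * (transition A k1 (k + 1))ᵀ

/-- The controllability Gramian `∑_{k0 ≤ k < k1} Φ(k0, k+1) B_k B_kᵀ Φ(k0, k+1)ᵀ`. -/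
def ctrlGramian {n m : ℕ} (A : ℕ → Matrix (Fin n) (Fin n) ℝ)
    (B : ℕ → Matrix (Fin n) (Fin m) ℝ) (k1 k0 : ℕ) : Matrix (Fin n) (Fin n) ℝ :=
  ∑ k ∈ Finset.Ico k0 k1,
    transition A k0 (k + 1) * B k * (B k)ᵀ * (transition A k0 (k + 1))ᵀ

/-! ### The data that determine the optimal control, for regularization parameter `1` -/

/-- `S_0 = G_c(N,0)^{-1/2} Σ_0 G_c(N,0)^{-1/2}`. -/
def normCovInit {n m : ℕ} (A : ℕ → Matrix (Fin n) (Fin n) ℝ)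
    (B : ℕ → Matrix (Fin n) (Fin m) ℝ) (N : ℕ) (Sig0 : Matrix (Fin n) (Fin n) ℝ) :
    Matrix (Fin n) (Fin n) ℝ :=
  (CFC.sqrt (ctrlGramian A B N 0))⁻¹ * Sig0 * (CFC.sqrt (ctrlGramian A B N 0))⁻¹

/-- `S_N = G_c(N,0)^{-1/2} Φ(0,N) Σ_N Φ(0,N)ᵀ G_c(N,0)^{-1/2}`. -/
def normCovTerm {n m : ℕ} (A : ℕ → Matrix (Fin n) (Fin n) ℝ)
    (B : ℕ → Matrix (Fin n) (Fin m) ℝ) (N : ℕ) (SigN : Matrix (Fin n) (Fin n) ℝ) :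
    Matrix (Fin n) (Fin n) ℝ :=
  (CFC.sqrt (ctrlGramian A B N 0))⁻¹ * (transition A 0 N * SigN * (transition A 0 N)ᵀ) *
    (CFC.sqrt (ctrlGramian A B N 0))⁻¹

/-- `(S_0^{1/2} S_N S_0^{1/2} + I/4)^{1/2}`. -/
def crossRoot {n : ℕ} (S0 SN : Matrix (Fin n) (Fin n) ℝ) : Matrix (Fin n) (Fin n) ℝ :=
  CFC.sqrt (CFC.sqrt S0 * SN * CFC.sqrt S0 + (1 / 4 : ℝ) • 1)

/-- `F(S_0, S_N) = S_0 + I/2 - (S_0^{1/2} S_N S_0^{1/2} + I/4)^{1/2}`. -/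
def forwardMat {n : ℕ} (S0 SN : Matrix (Fin n) (Fin n) ℝ) : Matrix (Fin n) (Fin n) ℝ :=
  S0 + (1 / 2 : ℝ) • 1 - crossRoot S0 SN

/-- `B(S_0, S_N) = -S_0 + I/2 + (S_0^{1/2} S_N S_0^{1/2} + I/4)^{1/2}`. -/
def backwardMat {n : ℕ} (S0 SN : Matrix (Fin n) (Fin n) ℝ) : Matrix (Fin n) (Fin n) ℝ :=
  -S0 + (1 / 2 : ℝ) • 1 + crossRoot S0 SN

/-- `Q_{-,0} = G_c(N,0)^{1/2} S_0^{1/2} F(S_0, S_N)⁻¹ S_0^{1/2} G_c(N,0)^{1/2}`. -/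
def QMinusInit {n m : ℕ} (A : ℕ → Matrix (Fin n) (Fin n) ℝ)
    (B : ℕ → Matrix (Fin n) (Fin m) ℝ) (N : ℕ) (Sig0 SigN : Matrix (Fin n) (Fin n) ℝ) :
    Matrix (Fin n) (Fin n) ℝ :=
  CFC.sqrt (ctrlGramian A B N 0) * CFC.sqrt (normCovInit A B N Sig0) *
    (forwardMat (normCovInit A B N Sig0) (normCovTerm A B N SigN))⁻¹ *
    CFC.sqrt (normCovInit A B N Sig0) * CFC.sqrt (ctrlGramian A B N 0)

/-- `Q_{-,k}`: the solution of `Q_{k+1} = A_k Q_k A_kᵀ - B_k B_kᵀ` that starts at `Q_{-,0}`. -/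
def QMinus {n m : ℕ} (A : ℕ → Matrix (Fin n) (Fin n) ℝ)
    (B : ℕ → Matrix (Fin n) (Fin m) ℝ) (N : ℕ) (Sig0 SigN : Matrix (Fin n) (Fin n) ℝ) :
    ℕ → Matrix (Fin n) (Fin n) ℝ
  | 0 => QMinusInit A B N Sig0 SigN
  | k + 1 => A k * QMinus A B N Sig0 SigN k * (A k)ᵀ - B k * (B k)ᵀ

/-- `I + B_kᵀ Q_{-,k+1}⁻¹ B_k`, the precision matrix of the optimal policy at time `k`. -/
def precision {n m : ℕ} (A : ℕ → Matrix (Fin n) (Fin n) ℝ)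
    (B : ℕ → Matrix (Fin n) (Fin m) ℝ) (N : ℕ) (Sig0 SigN : Matrix (Fin n) (Fin n) ℝ)
    (k : ℕ) : Matrix (Fin m) (Fin m) ℝ :=
  1 + (B k)ᵀ * (QMinus A B N Sig0 SigN (k + 1))⁻¹ * B k

/-- `A_{Q,k} = A_k - B_k (I + B_kᵀ Q_{-,k+1}⁻¹ B_k)⁻¹ B_kᵀ Q_{-,k+1}⁻¹ A_k`. -/
def AQ {n m : ℕ} (A : ℕ → Matrix (Fin n) (Fin n) ℝ)
    (B : ℕ → Matrix (Fin n) (Fin m) ℝ) (N : ℕ) (Sig0 SigN : Matrix (Fin n) (Fin n) ℝ)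
    (k : ℕ) : Matrix (Fin n) (Fin n) ℝ :=
  A k - B k * (precision A B N Sig0 SigN k)⁻¹ * (B k)ᵀ *
    (QMinus A B N Sig0 SigN (k + 1))⁻¹ * A k

/-- `B_{Q,k} = B_k (I + B_kᵀ Q_{-,k+1}⁻¹ B_k)^{-1/2}`. -/
def BQ {n m : ℕ} (A : ℕ → Matrix (Fin n) (Fin n) ℝ)
    (B : ℕ → Matrix (Fin n) (Fin m) ℝ) (N : ℕ) (Sig0 SigN : Matrix (Fin n) (Fin n) ℝ)
    (k : ℕ) : Matrix (Fin n) (Fin m) ℝ :=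
  B k * (CFC.sqrt (precision A B N Sig0 SigN k))⁻¹

/-! ### Path laws of noise-driven linear systems and the Schrödinger bridge problem -/

/-- The solution of `x (k+1) = A k x k + B k w k`, `x 0 = x0`, driven by the noise values
`w 0, …, w (N-1)`, on the time interval `0, …, N`. -/
def statePath {n m N : ℕ} (A : ℕ → Matrix (Fin n) (Fin n) ℝ)
    (B : ℕ → Matrix (Fin n) (Fin m) ℝ) (x0 : EuclideanSpace ℝ (Fin n))
    (w : Fin N → EuclideanSpace ℝ (Fin m)) (k : Fin (N + 1)) : EuclideanSpace ℝ (Fin n) :=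
  Fin.induction (motive := fun _ => EuclideanSpace ℝ (Fin n)) x0
    (fun (i : Fin N) x => Matrix.toEuclideanLin (A i) x + Matrix.toEuclideanLin (B i) (w i)) k

/-- The law on `(ℝⁿ)^{N+1}` of the solution of `x (k+1) = A k x k + B k w k`, where
`x 0 ∼ N(0, Sig0)`, `w k ∼ N(0, I)`, and `x 0, w 0, …, w (N-1)` are independent. -/
def pathLaw {n m : ℕ} (N : ℕ) (A : ℕ → Matrix (Fin n) (Fin n) ℝ)
    (B : ℕ → Matrix (Fin n) (Fin m) ℝ) (Sig0 : Matrix (Fin n) (Fin n) ℝ) :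
    Measure (Fin (N + 1) → EuclideanSpace ℝ (Fin n)) :=
  ((multivariateGaussian 0 Sig0).prod
    (Measure.pi fun _ : Fin N =>
      multivariateGaussian (0 : EuclideanSpace ℝ (Fin m)) (1 : Matrix (Fin m) (Fin m) ℝ))).map
    fun p => statePath A B p.1 p.2

/-- `P` is a probability distribution on `(ℝⁿ)^{N+1}` whose marginals at the times `0` and `N`
are `N(0, Sig0)` and `N(0, SigN)`. -/
structure HasEndMarginals {n N : ℕ} (Sig0 SigN : Matrix (Fin n) (Fin n) ℝ)
    (P : Measure (Fin (N + 1) → EuclideanSpace ℝ (Fin n))) : Prop where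
  isProbabilityMeasure : IsProbabilityMeasure P
  map_zero : P.map (fun x => x 0) = multivariateGaussian 0 Sig0
  map_last : P.map (fun x => x (Fin.last N)) = multivariateGaussian 0 SigN

/-- `P` is an optimal solution of the Schrödinger bridge problem with reference law `R`: it
minimizes `D_KL(· ‖ R)` among the distributions with end marginals `N(0, Sig0)`, `N(0, SigN)`. -/
def IsSchrodingerBridge {n N : ℕ} (R : Measure (Fin (N + 1) → EuclideanSpace ℝ (Fin n)))
    (Sig0 SigN : Matrix (Fin n) (Fin n) ℝ)
    (P : Measure (Fin (N + 1) → EuclideanSpace ℝ (Fin n))) : Prop :=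
  HasEndMarginals Sig0 SigN P ∧
    ∀ P' : Measure (Fin (N + 1) → EuclideanSpace ℝ (Fin n)),
      HasEndMarginals Sig0 SigN P' → klDiv P R ≤ klDiv P' R

end

/-! The closed-loop law is an exponential tilt of the reference law whose log-density,
`endpointPotential`, depends on the two end states only: up to a constant it is `½ x₀ᵀ Q₀⁻¹ x₀ - ½
x_Nᵀ Q_N⁻¹ x_N`. Its integral is therefore the same under every law with the prescribed end
marginals. Writing `R` for the reference law and `S` for the closed-loop law, this gives the
Pythagorean identity `KL(P ‖ R) = KL(P ‖ S) + KL(S ‖ R)` for every admissible `P` of finite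
divergence (`klDiv_eq_klDiv_tilted_add`), hence optimality and uniqueness together.

The tilt (`pathLaw_closedLoop_eq_tilted`) comes from comparing policies one step at a time.
Completing the square turns each log-likelihood ratio into a difference of the quadratic forms of
`Q_k⁻¹` and `Q_{k+1}⁻¹` along the trajectory (`norm_sq_sub_quadForm_precision`), and the sum over
time telescopes.

Two matrix facts remain. The policy must make sense (`QMinus_properties`) although `Q₀` may be
indefinite: the construction gives `G_c⁻¹ - Q₀⁻¹ > 0`, and since the partial Gramians lie between
`0` and `G_c`, this keeps all `Q_k` invertible and all precisions positive definite. The closed loop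
must also reach the terminal covariance (`closedLoopCov_terminal`): `Q⁻¹ Σ Q⁻¹ - Q⁻¹` is transported
by the uncontrolled dynamics, which reduces the claim to the quadratic equation `D² + D = S₀^{1/2}
S_N S₀^{1/2}` solved by `D = crossRoot - I/2`. -/

noncomputable section

/-! ### Positivity and the boundary value of the Riccati variable -/

section MatrixAlgebra

variable {n m : ℕ}

lemma Matrix.PosDef.sqrt_posDef {S : Matrix (Fin n) (Fin n) ℝ} (hS : S.PosDef) :
    (CFC.sqrt S).PosDef := by
  have h0 : (CFC.sqrt S).PosSemidef := Matrix.nonneg_iff_posSemidef.1 (CFC.sqrt_nonneg S)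
  rw [h0.posDef_iff_isUnit]
  have h1 : CFC.sqrt S * CFC.sqrt S = S := CFC.sqrt_mul_sqrt_self S hS.posSemidef.nonneg
  have h2 := hS.isUnit
  rw [← h1] at h2
  exact isUnit_of_mul_isUnit_left h2

lemma Matrix.PosDef.transpose_eq {S : Matrix (Fin n) (Fin n) ℝ} (hS : S.PosDef) : Sᵀ = S := by
  simpa [Matrix.conjTranspose_eq_transpose_of_trivial] using hS.isHermitian.eq

/-- If `R ≥ 0` and `R² = X + I/4` with `X` positive definite, then `R - I/2` is positive
definite. -/
lemma posDef_sub_half {R X : Matrix (Fin n) (Fin n) ℝ} (hR : R.PosSemidef) (hX : X.PosDef)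
    (h : R * R = X + (1 / 4 : ℝ) • 1) : (R - (1 / 2 : ℝ) • 1).PosDef := by
  have hD : (R - (1 / 2 : ℝ) • (1 : Matrix (Fin n) (Fin n) ℝ)).IsHermitian := by
    refine hR.isHermitian.sub ?_
    simp [Matrix.IsHermitian]
  rw [hD.posDef_iff_eigenvalues_pos]
  intro i
  set l := hD.eigenvalues i with hl
  set v : Fin n → ℝ := (hD.eigenvectorBasis i).ofLp with hv
  have hv0 : v ≠ 0 := by
    intro h0
    have := hD.eigenvectorBasis.orthonormal.ne_zero i
    apply this
    ext j
    exact congrFun h0 j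
  have hev : (R - (1 / 2 : ℝ) • (1 : Matrix (Fin n) (Fin n) ℝ)).mulVec v = l • v :=
    hD.mulVec_eigenvectorBasis i
  have hRv : R.mulVec v = (l + 1 / 2) • v := by
    rw [Matrix.sub_mulVec, Matrix.smul_mulVec, Matrix.one_mulVec] at hev
    rw [add_smul, ← hev]; abel
  have hXv : X.mulVec v = (l * (l + 1)) • v := by
    have : X = R * R - (1 / 4 : ℝ) • 1 := by rw [h]; abel
    rw [this, Matrix.sub_mulVec, ← Matrix.mulVec_mulVec, hRv, Matrix.mulVec_smul, hRv,
      Matrix.smul_mulVec, Matrix.one_mulVec, smul_smul, ← sub_smul]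
    congr 1; ring
  have hvv : 0 < v ⬝ᵥ v := by
    have := Matrix.dotProduct_star_self_pos_iff.2 hv0
    simpa using this
  have h1 := hR.dotProduct_mulVec_nonneg v
  have h2 := hX.dotProduct_mulVec_pos hv0
  rw [hRv] at h1
  rw [hXv] at h2
  simp only [star_trivial, dotProduct_smul, smul_eq_mul] at h1 h2
  have h3 : 0 ≤ l + 1 / 2 := nonneg_of_mul_nonneg_left h1 hvv
  have h4 : 0 < l * (l + 1) := pos_of_mul_pos_left h2 hvv.le
  -- `l ≥ -1/2` makes `l + 1` nonnegative, which selects the positive root in `l (l + 1) > 0`.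
  exact pos_of_mul_pos_left h4 (by linarith)

/-- If `y = G z + b v` and `G + b bᵀ ≤ T`, then `yᵀ T⁻¹ y ≤ |v|² + zᵀ G z`. -/
lemma dotProduct_inv_mulVec_le {G T : Matrix (Fin n) (Fin n) ℝ} {b : Matrix (Fin n) (Fin m) ℝ}
    (hG : G.PosSemidef) (hT : T.PosDef) (hGT : (T - G - b * bᵀ).PosSemidef)
    (z : Fin n → ℝ) (v : Fin m → ℝ) :
    (G *ᵥ z + b *ᵥ v) ⬝ᵥ T⁻¹ *ᵥ (G *ᵥ z + b *ᵥ v) ≤ v ⬝ᵥ v + z ⬝ᵥ G *ᵥ z := by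
  set y := G *ᵥ z + b *ᵥ v with hy
  set e := T⁻¹ *ᵥ y with he
  have hTe : T *ᵥ e = y := by
    rw [he, Matrix.mulVec_mulVec,
      Matrix.mul_nonsing_inv _ ((Matrix.isUnit_iff_isUnit_det _).1 hT.isUnit), Matrix.one_mulVec]
  -- With `e = T⁻¹ y`, the claim is the sum of three nonnegative terms: `eᵀ (T - G - b bᵀ) e`, `(e -
  -- z)ᵀ G (e - z)` and `|bᵀ e - v|²`.
  have h1 := hGT.dotProduct_mulVec_nonneg e
  have h2 := hG.dotProduct_mulVec_nonneg (e - z)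
  have h3 : 0 ≤ (bᵀ *ᵥ e - v) ⬝ᵥ (bᵀ *ᵥ e - v) := by
    simpa using dotProduct_star_self_nonneg (bᵀ *ᵥ e - v)
  have hsym : e ⬝ᵥ G *ᵥ z = z ⬝ᵥ G *ᵥ e := by
    rw [Matrix.dotProduct_mulVec, ← Matrix.mulVec_transpose, dotProduct_comm]
    congr 2
    simpa [Matrix.conjTranspose_eq_transpose_of_trivial] using hG.isHermitian.eq
  have hb : (bᵀ *ᵥ e) ⬝ᵥ v = e ⬝ᵥ b *ᵥ v := by
    rw [Matrix.mulVec_transpose, Matrix.dotProduct_mulVec]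
  have hbb : e ⬝ᵥ (b * bᵀ) *ᵥ e = (bᵀ *ᵥ e) ⬝ᵥ (bᵀ *ᵥ e) := by
    rw [← Matrix.mulVec_mulVec, Matrix.dotProduct_mulVec, ← Matrix.mulVec_transpose]
  have hye : y ⬝ᵥ e = e ⬝ᵥ G *ᵥ z + e ⬝ᵥ b *ᵥ v := by
    rw [dotProduct_comm, hy, dotProduct_add]
  simp only [star_trivial, Matrix.sub_mulVec, Matrix.mulVec_sub, dotProduct_sub,
    sub_dotProduct, hTe] at h1 h2 h3
  have hv' : v ⬝ᵥ (bᵀ *ᵥ e) = (bᵀ *ᵥ e) ⬝ᵥ v := dotProduct_comm _ _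
  have hey : e ⬝ᵥ y = y ⬝ᵥ e := dotProduct_comm _ _
  linarith

/-- A kernel vector satisfies `Q z = G z =: y`, so `yᵀ T⁻¹ y ≤ zᵀ G z = yᵀ Q⁻¹ y`, which contradicts
`T⁻¹ > Q⁻¹` unless `y = 0`. No sign of `Q` is involved. -/
lemma isUnit_sub_of_posSemidef {Q G T : Matrix (Fin n) (Fin n) ℝ} (hQ : IsUnit Q)
    (hG : G.PosSemidef) (hT : T.PosDef) (hGT : (T - G).PosSemidef)
    (hTQ : (T⁻¹ - Q⁻¹).PosDef) : IsUnit (Q - G) := by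
  rw [← Matrix.mulVec_injective_iff_isUnit, ← Matrix.coe_mulVecLin,
    injective_iff_map_eq_zero]
  intro z hz
  rw [Matrix.mulVecLin_apply, Matrix.sub_mulVec, sub_eq_zero] at hz
  have h := dotProduct_inv_mulVec_le (b := (0 : Matrix (Fin n) (Fin 0) ℝ)) hG hT
    (by simpa using hGT) z 0
  simp only [Matrix.zero_mulVec, add_zero, dotProduct_zero, zero_add] at h
  rw [← hz] at h
  have hzz : Q⁻¹ *ᵥ (Q *ᵥ z) = z := by
    rw [Matrix.mulVec_mulVec, Matrix.nonsing_inv_mul _ ((Matrix.isUnit_iff_isUnit_det _).1 hQ),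
      Matrix.one_mulVec]
  by_contra hz0
  have hy : Q *ᵥ z ≠ 0 := by
    intro h0
    rw [h0, Matrix.mulVec_zero] at hzz
    exact hz0 hzz.symm
  have := hTQ.dotProduct_mulVec_pos hy
  rw [Matrix.sub_mulVec, dotProduct_sub, hzz, star_trivial, dotProduct_comm _ z] at this
  linarith

/-- For `z = (Q - G)⁻¹ b v` the form at `v` equals `|v|² + zᵀ G z - zᵀ Q z`. As `Q z = G z + b v`,
the previous inequality bounds the first two terms below by `yᵀ T⁻¹ y` with `y = Q z`, and this
exceeds `yᵀ Q⁻¹ y = zᵀ Q z`. It is applied to the inverse precision matrix. -/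
lemma posDef_one_sub_of_posSemidef {Q G T : Matrix (Fin n) (Fin n) ℝ}
    {b : Matrix (Fin n) (Fin m) ℝ} (hQ : IsUnit Q) (hQs : Qᵀ = Q)
    (hG : G.PosSemidef) (hT : T.PosDef) (hGT : (T - G - b * bᵀ).PosSemidef)
    (hTQ : (T⁻¹ - Q⁻¹).PosDef) (hQG : IsUnit (Q - G)) :
    (1 - bᵀ * (Q - G)⁻¹ * b).PosDef := by
  have hGs : Gᵀ = G := by
    simpa [Matrix.conjTranspose_eq_transpose_of_trivial] using hG.isHermitian.eq
  refine Matrix.PosDef.of_dotProduct_mulVec_pos ?_ fun v hv => ?_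
  · rw [Matrix.IsHermitian, Matrix.conjTranspose_eq_transpose_of_trivial]
    simp [Matrix.transpose_mul, Matrix.transpose_nonsing_inv, hQs, hGs, Matrix.mul_assoc]
  set z := (Q - G)⁻¹ *ᵥ (b *ᵥ v) with hz
  have hQz : (Q - G) *ᵥ z = b *ᵥ v := by
    rw [hz, Matrix.mulVec_mulVec, Matrix.mul_nonsing_inv _
      ((Matrix.isUnit_iff_isUnit_det _).1 hQG), Matrix.one_mulVec]
  have hQz' : G *ᵥ z + b *ᵥ v = Q *ᵥ z := by
    rw [← hQz, Matrix.sub_mulVec]; abel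
  have hzz : Q⁻¹ *ᵥ (Q *ᵥ z) = z := by
    rw [Matrix.mulVec_mulVec, Matrix.nonsing_inv_mul _ ((Matrix.isUnit_iff_isUnit_det _).1 hQ),
      Matrix.one_mulVec]
  have h := dotProduct_inv_mulVec_le hG hT hGT z v
  have hgoal : v ⬝ᵥ (1 - bᵀ * (Q - G)⁻¹ * b) *ᵥ v = v ⬝ᵥ v - z ⬝ᵥ (Q *ᵥ z - G *ᵥ z) := by
    rw [Matrix.sub_mulVec, Matrix.one_mulVec, dotProduct_sub, ← Matrix.sub_mulVec, hQz,
      ← Matrix.mulVec_mulVec, ← Matrix.mulVec_mulVec, ← hz, Matrix.dotProduct_mulVec,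
      ← Matrix.mulVec_transpose, Matrix.transpose_transpose, dotProduct_comm z]
  rw [star_trivial, hgoal, dotProduct_sub]
  rw [hQz'] at h
  -- The strict inequality needs `Q z ≠ 0`; otherwise `z = 0` and the form is `|v|²`.
  by_cases hy : Q *ᵥ z = 0
  · rw [hy, Matrix.mulVec_zero] at hzz
    have hvv : 0 < v ⬝ᵥ v := by
      have := Matrix.dotProduct_star_self_pos_iff.2 hv
      simpa using this
    simpa [← hzz] using hvv
  · have := hTQ.dotProduct_mulVec_pos hy
    rw [Matrix.sub_mulVec, dotProduct_sub, hzz, star_trivial, dotProduct_comm _ z] at this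
    linarith

lemma Matrix.mul_inv_of_isUnit {S : Matrix (Fin n) (Fin n) ℝ} (h : IsUnit S) : S * S⁻¹ = 1 :=
  Matrix.mul_nonsing_inv _ ((Matrix.isUnit_iff_isUnit_det _).1 h)

lemma Matrix.inv_mul_of_isUnit {S : Matrix (Fin n) (Fin n) ℝ} (h : IsUnit S) : S⁻¹ * S = 1 :=
  Matrix.nonsing_inv_mul _ ((Matrix.isUnit_iff_isUnit_det _).1 h)

/-- The algebra behind the boundary value of the backward Riccati variable: if `h`, `s` are
invertible, `F = s² - D` and `D² + D = s S s`, then `Q = h s F⁻¹ s h` transports the initial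
covariance `h s² h` to the terminal one. -/
lemma boundary_identity {h s F D S Q : Matrix (Fin n) (Fin n) ℝ} (hh : IsUnit h) (hs : IsUnit s)
    (hF : IsUnit F) (hFD : F = s * s - D) (hD : D * D + D = s * S * s)
    (hQ : Q = h * s * F⁻¹ * s * h) :
    IsUnit Q ∧ Q⁻¹ = h⁻¹ * s⁻¹ * F * s⁻¹ * h⁻¹ ∧
      (h * h)⁻¹ - Q⁻¹ = (h⁻¹ * s⁻¹) * D * (s⁻¹ * h⁻¹) ∧
      (Q - h * h) + (Q - h * h) * (Q⁻¹ * (h * s * s * h) * Q⁻¹ - Q⁻¹) * (Q - h * h) =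
        h * S * h := by
  have h1 := Matrix.mul_inv_of_isUnit hh
  have h2 := Matrix.inv_mul_of_isUnit hh
  have s1 := Matrix.mul_inv_of_isUnit hs
  have s2 := Matrix.inv_mul_of_isUnit hs
  have f2 := Matrix.inv_mul_of_isUnit hF
  have h1' (x : Matrix (Fin n) (Fin n) ℝ) : h * (h⁻¹ * x) = x := by
    rw [← Matrix.mul_assoc, h1, one_mul]
  have h2' (x : Matrix (Fin n) (Fin n) ℝ) : h⁻¹ * (h * x) = x := by
    rw [← Matrix.mul_assoc, h2, one_mul]
  have s1' (x : Matrix (Fin n) (Fin n) ℝ) : s * (s⁻¹ * x) = x := by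
    rw [← Matrix.mul_assoc, s1, one_mul]
  have s2' (x : Matrix (Fin n) (Fin n) ℝ) : s⁻¹ * (s * x) = x := by
    rw [← Matrix.mul_assoc, s2, one_mul]
  have f2' (x : Matrix (Fin n) (Fin n) ℝ) : F⁻¹ * (F * x) = x := by
    rw [← Matrix.mul_assoc, f2, one_mul]
  have hinv : Q⁻¹ = h⁻¹ * s⁻¹ * F * s⁻¹ * h⁻¹ := by
    apply Matrix.inv_eq_right_inv
    simp only [hQ, Matrix.mul_assoc, h1', s1', f2', h1]
  have hQu : IsUnit Q := by
    rw [hQ]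
    have : IsUnit F⁻¹ := by
      rw [Matrix.isUnit_nonsing_inv_iff]; exact hF
    exact (((hh.mul hs).mul this).mul hs).mul hh
  have hQ1 := Matrix.mul_inv_of_isUnit hQu
  have hQ2 := Matrix.inv_mul_of_isUnit hQu
  -- For `K = Q - h²`, both `K Q⁻¹` and `Q⁻¹ K` are `D` up to factors of `h` and `s`, because `s² -
  -- F = D`. Hence `K Q⁻¹ (h s² h) Q⁻¹ K` produces `D²`, and `K - K Q⁻¹ K` produces `D`.
  have hKl : (Q - h * h) * Q⁻¹ = h * s⁻¹ * D * s⁻¹ * h⁻¹ := by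
    rw [Matrix.sub_mul, hQ1, hinv, hFD]
    simp only [Matrix.mul_assoc, Matrix.mul_sub, Matrix.sub_mul, h1', s1', s2', h1]
    abel
  have hKr : Q⁻¹ * (Q - h * h) = h⁻¹ * s⁻¹ * D * s⁻¹ * h := by
    rw [Matrix.mul_sub, hQ2, hinv, hFD]
    simp only [Matrix.mul_assoc, Matrix.mul_sub, Matrix.sub_mul, h2', s1', s2', h2]
    abel
  refine ⟨hQu, hinv, ?_, ?_⟩
  · rw [Matrix.mul_inv_rev, hinv, hFD]
    simp only [Matrix.mul_assoc, Matrix.mul_sub, Matrix.sub_mul, s1', s2']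
    abel
  · have e1 : (Q - h * h) * (Q⁻¹ * (h * s * s * h) * Q⁻¹) * (Q - h * h) =
        h * s⁻¹ * (D * D) * s⁻¹ * h := by
      calc _ = ((Q - h * h) * Q⁻¹) * (h * s * s * h) * (Q⁻¹ * (Q - h * h)) := by
            simp only [Matrix.mul_assoc]
        _ = _ := by
            rw [hKl, hKr]
            simp only [Matrix.mul_assoc, h1', h2', s1', s2']
    have e2 : (Q - h * h) * Q⁻¹ * (Q - h * h) = (Q - h * h) - h * s⁻¹ * D * s⁻¹ * h := by
      rw [Matrix.mul_assoc, hKr, Matrix.sub_mul]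
      have : h * h * (h⁻¹ * s⁻¹ * D * s⁻¹ * h) = h * s⁻¹ * D * s⁻¹ * h := by
        simp only [Matrix.mul_assoc, h1']
      have h' : Q * (h⁻¹ * s⁻¹ * D * s⁻¹ * h) = Q - h * h := by
        rw [← hKr, ← Matrix.mul_assoc, hQ1, one_mul]
      rw [this, h']
    rw [Matrix.mul_sub (Q - h * h), Matrix.sub_mul _ _ (Q - h * h), e1, e2]
    have : h * S * h = h * s⁻¹ * (D * D + D) * s⁻¹ * h := by
      rw [hD]; simp only [Matrix.mul_assoc, s2', s1']
    rw [this]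
    simp only [Matrix.mul_add, Matrix.add_mul]
    abel

/-! ### One step of the Riccati recursion -/

variable {A Q Q' : Matrix (Fin n) (Fin n) ℝ} {B : Matrix (Fin n) (Fin m) ℝ}

/-- One step of the Riccati recursion in terms of the matrix inversion lemma. -/
lemma one_sub_mul_precision (hQ' : IsUnit Q') (hU : IsUnit (Q' + B * Bᵀ)) :
    (1 - Bᵀ * (Q' + B * Bᵀ)⁻¹ * B) * (1 + Bᵀ * Q'⁻¹ * B) = 1 := by
  have hU2 := Matrix.inv_mul_of_isUnit hU
  have hQ1 := Matrix.mul_inv_of_isUnit hQ'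
  set U := Q' + B * Bᵀ with hUdef
  have hBB : B * Bᵀ = U - Q' := by rw [hUdef]; abel
  have : Bᵀ * U⁻¹ * B * (Bᵀ * Q'⁻¹ * B) = Bᵀ * Q'⁻¹ * B - Bᵀ * U⁻¹ * B := by
    calc _ = Bᵀ * (U⁻¹ * (B * Bᵀ) * Q'⁻¹) * B := by simp only [Matrix.mul_assoc]
      _ = _ := by
        rw [hBB, Matrix.mul_sub, hU2, Matrix.sub_mul, Matrix.mul_assoc U⁻¹, hQ1]
        simp only [Matrix.mul_sub, Matrix.sub_mul, one_mul, mul_one]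
  rw [Matrix.sub_mul, Matrix.mul_add (Bᵀ * U⁻¹ * B), this]
  simp only [one_mul, mul_one]
  abel

lemma precision_inv (hQ' : IsUnit Q') (hU : IsUnit (Q' + B * Bᵀ)) :
    (1 + Bᵀ * Q'⁻¹ * B)⁻¹ = 1 - Bᵀ * (Q' + B * Bᵀ)⁻¹ * B :=
  Matrix.inv_eq_left_inv (one_sub_mul_precision hQ' hU)

/-- With `U = Q' + B Bᵀ`, substituting `B Bᵀ = U - Q'` eliminates `B` from the closed-loop noise
covariance. -/
lemma mul_precision_inv_mul (hQ' : IsUnit Q') (hU : IsUnit (Q' + B * Bᵀ)) :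
    B * (1 + Bᵀ * Q'⁻¹ * B)⁻¹ * Bᵀ = Q' - Q' * (Q' + B * Bᵀ)⁻¹ * Q' := by
  rw [precision_inv hQ' hU]
  have hU1 := Matrix.mul_inv_of_isUnit hU
  have hU2 := Matrix.inv_mul_of_isUnit hU
  set U := Q' + B * Bᵀ with hUdef
  have hBB : B * Bᵀ = U - Q' := by rw [hUdef]; abel
  calc _ = B * Bᵀ - (B * Bᵀ) * U⁻¹ * (B * Bᵀ) := by
        simp only [Matrix.mul_sub, Matrix.sub_mul, Matrix.one_mul, Matrix.mul_assoc]
    _ = _ := by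
        rw [hBB]
        simp only [Matrix.sub_mul, Matrix.mul_sub, hU1, one_mul, Matrix.mul_assoc, hU2, mul_one]
        abel

/-- When `Q' + B Bᵀ = A Q Aᵀ`, this factor becomes `Q' A⁻ᵀ Q⁻¹`: in the coordinates `Q⁻¹ x` the
closed loop acts as `A⁻ᵀ`. This is what makes the covariance recursion linear and simple. -/
lemma closedLoop_eq (hQ' : IsUnit Q') (hU : IsUnit (Q' + B * Bᵀ)) :
    A - B * (1 + Bᵀ * Q'⁻¹ * B)⁻¹ * Bᵀ * Q'⁻¹ * A = Q' * (Q' + B * Bᵀ)⁻¹ * A := by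
  have hQ1 := Matrix.mul_inv_of_isUnit hQ'
  rw [mul_precision_inv_mul hQ' hU, Matrix.sub_mul Q', hQ1, Matrix.mul_assoc _ Q', hQ1,
    Matrix.sub_mul, mul_one, one_mul, sub_sub_cancel]

/-- No invertibility is needed, since the nonsingular inverse reverses products unconditionally. -/
lemma inv_eq_of_recursion (h : Q' + B * Bᵀ = A * Q * Aᵀ) :
    (Q' + B * Bᵀ)⁻¹ = (A⁻¹)ᵀ * Q⁻¹ * A⁻¹ := by
  rw [h, Matrix.mul_inv_rev, Matrix.mul_inv_rev, Matrix.transpose_nonsing_inv, Matrix.mul_assoc]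

/-- The value matrix recursion: completing the square in the control. -/
lemma value_recursion (hA : IsUnit A) (hQ' : IsUnit Q') (hU : IsUnit (Q' + B * Bᵀ))
    (h : Q' + B * Bᵀ = A * Q * Aᵀ) :
    Aᵀ * Q'⁻¹ * A - Aᵀ * Q'⁻¹ * (B * (1 + Bᵀ * Q'⁻¹ * B)⁻¹ * Bᵀ) * Q'⁻¹ * A = Q⁻¹ := by
  have hQ1 := Matrix.mul_inv_of_isUnit hQ'
  have hQ2 := Matrix.inv_mul_of_isUnit hQ'
  have hA2 := Matrix.inv_mul_of_isUnit hA
  have hA2' : Aᵀ * (A⁻¹)ᵀ = 1 := by rw [← Matrix.transpose_mul, hA2, Matrix.transpose_one]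
  rw [mul_precision_inv_mul hQ' hU]
  calc _ = Aᵀ * Q'⁻¹ * A - Aᵀ * (Q'⁻¹ * Q') * Q'⁻¹ * A +
        Aᵀ * (Q'⁻¹ * Q') * (Q' + B * Bᵀ)⁻¹ * (Q' * Q'⁻¹) * A := by
          simp only [Matrix.mul_sub, Matrix.sub_mul, Matrix.mul_assoc]; abel
    _ = Aᵀ * (Q' + B * Bᵀ)⁻¹ * A := by
          rw [hQ2, hQ1]; simp only [mul_one]; abel
    _ = (Aᵀ * (A⁻¹)ᵀ) * Q⁻¹ * (A⁻¹ * A) := by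
          rw [inv_eq_of_recursion h]; simp only [Matrix.mul_assoc]
    _ = Q⁻¹ := by rw [hA2', hA2, one_mul, mul_one]

/-- `Q⁻¹ Σ Q⁻¹ - Q⁻¹` is transported by `A⁻¹` under the closed-loop covariance recursion. -/
lemma covariance_recursion (hA : IsUnit A) (hQ' : IsUnit Q') (hU : IsUnit (Q' + B * Bᵀ))
    (hQs : Qᵀ = Q) (hQs' : Q'ᵀ = Q') (h : Q' + B * Bᵀ = A * Q * Aᵀ)
    (Sig : Matrix (Fin n) (Fin n) ℝ) :
    Q'⁻¹ * ((A - B * (1 + Bᵀ * Q'⁻¹ * B)⁻¹ * Bᵀ * Q'⁻¹ * A) * Sig *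
        (A - B * (1 + Bᵀ * Q'⁻¹ * B)⁻¹ * Bᵀ * Q'⁻¹ * A)ᵀ +
        B * (1 + Bᵀ * Q'⁻¹ * B)⁻¹ * Bᵀ) * Q'⁻¹ - Q'⁻¹ =
      (A⁻¹)ᵀ * (Q⁻¹ * Sig * Q⁻¹ - Q⁻¹) * A⁻¹ := by
  have hQ1 := Matrix.mul_inv_of_isUnit hQ'
  have hQ2 := Matrix.inv_mul_of_isUnit hQ'
  have hA2 := Matrix.inv_mul_of_isUnit hA
  have hQis : (Q⁻¹)ᵀ = Q⁻¹ := by rw [Matrix.transpose_nonsing_inv, hQs]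
  have hQ2' (x : Matrix (Fin n) (Fin n) ℝ) : Q'⁻¹ * (Q' * x) = x := by
    rw [← Matrix.mul_assoc, hQ2, one_mul]
  have hA2' (x : Matrix (Fin n) (Fin n) ℝ) : Aᵀ * ((A⁻¹)ᵀ * x) = x := by
    rw [← Matrix.mul_assoc, ← Matrix.transpose_mul, hA2, Matrix.transpose_one, one_mul]
  have hcl : A - B * (1 + Bᵀ * Q'⁻¹ * B)⁻¹ * Bᵀ * Q'⁻¹ * A = Q' * ((A⁻¹)ᵀ * Q⁻¹) := by
    rw [closedLoop_eq hQ' hU, inv_eq_of_recursion h]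
    simp only [Matrix.mul_assoc, hA2, mul_one]
  rw [hcl, mul_precision_inv_mul hQ' hU, inv_eq_of_recursion h]
  simp only [Matrix.transpose_mul, Matrix.transpose_transpose, hQis, hQs', Matrix.mul_add,
    Matrix.add_mul, Matrix.mul_sub, Matrix.sub_mul, Matrix.mul_assoc, hQ2', hQ1, mul_one]
  abel

end MatrixAlgebra

/-! ### Gramians, the Riccati variable along time, and the terminal covariance -/

section Dynamics

variable {n m N : ℕ} {A : ℕ → Matrix (Fin n) (Fin n) ℝ} {B : ℕ → Matrix (Fin n) (Fin m) ℝ}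

lemma isUnit_forwardProd (hA : ∀ k < N, IsUnit (A k)) :
    ∀ k ≤ N, IsUnit (forwardProd A 0 k)
  | 0, _ => isUnit_one
  | k + 1, hk => by
    rw [forwardProd, zero_add]
    exact (hA k hk).mul (isUnit_forwardProd hA k (Nat.le_of_succ_le hk))

lemma transition_zero_left (k : ℕ) : transition A 0 k = (forwardProd A 0 k)⁻¹ := by
  have h : ∀ k, backwardProd A 0 k = (forwardProd A 0 k)⁻¹ := by
    intro k
    induction k with
    | zero => simp [backwardProd, forwardProd]
    | succ k ih => rw [backwardProd, forwardProd, ih, Matrix.mul_inv_rev]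
  rcases Nat.eq_zero_or_pos k with rfl | hk
  · simp [transition, forwardProd]
  · rw [transition, if_neg (by omega), Nat.sub_zero, h]

lemma forwardProd_mul_forwardProd (j d : ℕ) :
    forwardProd A j d * forwardProd A 0 j = forwardProd A 0 (j + d) := by
  induction d with
  | zero => simp [forwardProd]
  | succ d ih => rw [forwardProd, Matrix.mul_assoc, ih, ← Nat.add_assoc, forwardProd, zero_add]

/-- Termwise from `Φ(N, k+1) = Φ(N, 0) Φ(0, k+1)`. It transfers the invertibility assumption from
the reachability to the controllability Gramian. -/
lemma reachGramian_zero_right (hA : ∀ k < N, IsUnit (A k)) :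
    reachGramian A B N 0 = forwardProd A 0 N * ctrlGramian A B N 0 * (forwardProd A 0 N)ᵀ := by
  rw [reachGramian, ctrlGramian, Matrix.mul_sum, Matrix.sum_mul]
  refine Finset.sum_congr rfl fun k hk => ?_
  have hk' : k + 1 ≤ N := (Finset.mem_Ico.1 hk).2
  have h : transition A N (k + 1) = forwardProd A 0 N * transition A 0 (k + 1) := by
    have h1 : forwardProd A 0 N =
        forwardProd A (k + 1) (N - (k + 1)) * forwardProd A 0 (k + 1) := by
      rw [forwardProd_mul_forwardProd]; congr 1; omega
    rw [transition_zero_left, h1, Matrix.mul_assoc,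
      Matrix.mul_inv_of_isUnit (isUnit_forwardProd hA _ hk'), mul_one, transition, if_pos hk']
  rw [h]
  simp only [Matrix.transpose_mul, Matrix.mul_assoc]

lemma ctrlGramian_succ (k : ℕ) : ctrlGramian A B (k + 1) 0 = ctrlGramian A B k 0 +
    ((forwardProd A 0 (k + 1))⁻¹ * B k) * ((forwardProd A 0 (k + 1))⁻¹ * B k)ᵀ := by
  rw [ctrlGramian, Finset.sum_Ico_succ_top (Nat.zero_le k), ← ctrlGramian, transition_zero_left,
    Matrix.transpose_mul]
  simp only [Matrix.mul_assoc]

lemma posSemidef_mul_transpose (C : Matrix (Fin n) (Fin m) ℝ) : (C * Cᵀ).PosSemidef := by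
  simpa [Matrix.conjTranspose_eq_transpose_of_trivial] using
    Matrix.posSemidef_self_mul_conjTranspose C

/-- Each time step adds a term `C Cᵀ`, so the partial Gramians increase from `0` to `G_c(N, 0)`; the
Riccati variable is controlled through this chain. -/
lemma posSemidef_ctrlGramian_sub {j k : ℕ} (hjk : j ≤ k) :
    (ctrlGramian A B k 0 - ctrlGramian A B j 0).PosSemidef := by
  induction k, hjk using Nat.le_induction with
  | base => simpa using Matrix.PosSemidef.zero
  | succ k _ ih =>
    rw [ctrlGramian_succ, add_sub_right_comm]
    exact ih.add (posSemidef_mul_transpose _)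

lemma posSemidef_ctrlGramian (k : ℕ) : (ctrlGramian A B k 0).PosSemidef := by
  have h := posSemidef_ctrlGramian_sub (A := A) (B := B) (Nat.zero_le k)
  simpa [ctrlGramian] using h

lemma posDef_ctrlGramian (hA : ∀ k < N, IsUnit (A k)) (hG : IsUnit (reachGramian A B N 0)) :
    (ctrlGramian A B N 0).PosDef := by
  rw [(posSemidef_ctrlGramian N).posDef_iff_isUnit]
  rw [reachGramian_zero_right hA] at hG
  exact isUnit_of_mul_isUnit_right (isUnit_of_mul_isUnit_left hG)

variable {Sig0 SigN : Matrix (Fin n) (Fin n) ℝ}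

/-- Pulled back to time `0`, the recursion only subtracts the growing Gramian, so everything about
`Q_k` becomes a statement on `Q₀ - G_c(k, 0)`. -/
lemma QMinus_eq (hA : ∀ k < N, IsUnit (A k)) : ∀ k ≤ N, QMinus A B N Sig0 SigN k =
    forwardProd A 0 k * (QMinusInit A B N Sig0 SigN - ctrlGramian A B k 0) *
      (forwardProd A 0 k)ᵀ
  | 0, _ => by simp [QMinus, forwardProd, ctrlGramian]
  | k + 1, hk => by
    have hU := Matrix.mul_inv_of_isUnit (isUnit_forwardProd hA (k + 1) hk)
    rw [QMinus, QMinus_eq hA k (Nat.le_of_succ_le hk), ctrlGramian_succ, ← sub_sub,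
      Matrix.mul_sub (forwardProd A 0 (k + 1)), Matrix.sub_mul]
    congr 1
    · simp only [forwardProd, zero_add, Matrix.transpose_mul, Matrix.mul_assoc]
    · have : forwardProd A 0 (k + 1) * ((forwardProd A 0 (k + 1))⁻¹ * B k) = B k := by
        rw [← Matrix.mul_assoc, hU, Matrix.one_mul]
      calc B k * (B k)ᵀ = (forwardProd A 0 (k + 1) * ((forwardProd A 0 (k + 1))⁻¹ * B k)) *
            (forwardProd A 0 (k + 1) * ((forwardProd A 0 (k + 1))⁻¹ * B k))ᵀ := by rw [this]
        _ = _ := by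
          rw [Matrix.transpose_mul (forwardProd A 0 (k + 1))]
          simp only [Matrix.mul_assoc]

lemma transpose_inv_sqrt {S : Matrix (Fin n) (Fin n) ℝ} (hS : S.PosDef) :
    ((CFC.sqrt S)⁻¹)ᵀ = (CFC.sqrt S)⁻¹ := by
  rw [Matrix.transpose_nonsing_inv, hS.sqrt_posDef.transpose_eq]

lemma Matrix.PosDef.mul_mul_transpose_of_isUnit {S C : Matrix (Fin n) (Fin n) ℝ} (hS : S.PosDef)
    (hC : IsUnit C) : (C * S * Cᵀ).PosDef := by
  have := (Matrix.IsUnit.posDef_star_right_conjugate_iff (x := S) hC).2 hS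
  rwa [Matrix.star_eq_conjTranspose, Matrix.conjTranspose_eq_transpose_of_trivial] at this

/-- The initial value of the Riccati variable: it is invertible and symmetric, its inverse is
smaller than that of the Gramian, and it connects the two prescribed covariances. -/
lemma QMinusInit_properties (hSig0 : Sig0.PosDef) (hSigN : SigN.PosDef)
    (hA : ∀ k < N, IsUnit (A k)) (hG : (ctrlGramian A B N 0).PosDef)
    (hF : IsUnit (forwardMat (normCovInit A B N Sig0) (normCovTerm A B N SigN))) :
    IsUnit (QMinusInit A B N Sig0 SigN) ∧
    (QMinusInit A B N Sig0 SigN)ᵀ = QMinusInit A B N Sig0 SigN ∧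
    ((ctrlGramian A B N 0)⁻¹ - (QMinusInit A B N Sig0 SigN)⁻¹).PosDef ∧
    (QMinusInit A B N Sig0 SigN - ctrlGramian A B N 0) +
      (QMinusInit A B N Sig0 SigN - ctrlGramian A B N 0) *
      ((QMinusInit A B N Sig0 SigN)⁻¹ * Sig0 * (QMinusInit A B N Sig0 SigN)⁻¹ -
        (QMinusInit A B N Sig0 SigN)⁻¹) *
      (QMinusInit A B N Sig0 SigN - ctrlGramian A B N 0) =
      (forwardProd A 0 N)⁻¹ * SigN * ((forwardProd A 0 N)⁻¹)ᵀ := by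
  set T := ctrlGramian A B N 0 with hT
  set h := CFC.sqrt T with hh
  set S0 := normCovInit A B N Sig0 with hS0
  set SN := normCovTerm A B N SigN with hSN
  set s := CFC.sqrt S0 with hs
  have hhT : h * h = T := CFC.sqrt_mul_sqrt_self T hG.posSemidef.nonneg
  have hhp : h.PosDef := hG.sqrt_posDef
  have hhi : (h⁻¹)ᵀ = h⁻¹ := transpose_inv_sqrt hG
  have hhu : IsUnit h⁻¹ := Matrix.isUnit_nonsing_inv_iff.2 hhp.isUnit
  have h1 := Matrix.mul_inv_of_isUnit hhp.isUnit
  have h2 := Matrix.inv_mul_of_isUnit hhp.isUnit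
  have hS0p : S0.PosDef := by
    have := hSig0.mul_mul_transpose_of_isUnit hhu
    rwa [hhi] at this
  have hPhi : IsUnit (forwardProd A 0 N)⁻¹ :=
    Matrix.isUnit_nonsing_inv_iff.2 (isUnit_forwardProd hA N le_rfl)
  have hSNp : SN.PosDef := by
    have := (hSigN.mul_mul_transpose_of_isUnit hPhi).mul_mul_transpose_of_isUnit hhu
    rw [hhi] at this
    rwa [hSN, normCovTerm, transition_zero_left]
  have hsp : s.PosDef := hS0p.sqrt_posDef
  have hsS : s * s = S0 := CFC.sqrt_mul_sqrt_self S0 hS0p.posSemidef.nonneg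
  have hX : (s * SN * s).PosDef := by
    have := hSNp.mul_mul_transpose_of_isUnit hsp.isUnit
    rwa [hsp.transpose_eq] at this
  have hX4 : (s * SN * s + (1 / 4 : ℝ) • (1 : Matrix (Fin n) (Fin n) ℝ)).PosSemidef :=
    hX.posSemidef.add (Matrix.PosSemidef.one.smul (by norm_num))
  have hRR : crossRoot S0 SN * crossRoot S0 SN = s * SN * s + (1 / 4 : ℝ) • 1 :=
    CFC.sqrt_mul_sqrt_self _ hX4.nonneg
  have hRp : (crossRoot S0 SN).PosSemidef :=
    Matrix.nonneg_iff_posSemidef.1 (CFC.sqrt_nonneg _)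
  -- Subtracting `I/2` completes the square: `D² + D = (D + I/2)² - I/4`. The same shift gives `F =
  -- S₀ - D`.
  set D := crossRoot S0 SN - (1 / 2 : ℝ) • (1 : Matrix (Fin n) (Fin n) ℝ) with hD
  have hDp : D.PosDef := posDef_sub_half hRp hX hRR
  have hFD : forwardMat S0 SN = s * s - D := by
    rw [forwardMat, hsS, hD]; abel
  have hDD : D * D + D = s * SN * s := by
    have : s * SN * s = crossRoot S0 SN * crossRoot S0 SN - (1 / 4 : ℝ) • 1 := by
      rw [hRR]; abel
    rw [this, hD]
    simp only [Matrix.mul_sub, Matrix.sub_mul, Matrix.mul_smul, Matrix.smul_mul, Matrix.mul_one,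
      Matrix.one_mul]
    module
  obtain ⟨q1, q2, q3, q4⟩ := boundary_identity hhp.isUnit hsp.isUnit hF hFD hDD
    (show QMinusInit A B N Sig0 SigN = _ from rfl)
  have hsig : h * s * s * h = Sig0 := by
    rw [Matrix.mul_assoc h s s, hsS, hS0, normCovInit, ← hT, ← hh]
    calc _ = (h * h⁻¹) * Sig0 * (h⁻¹ * h) := by simp only [Matrix.mul_assoc]
      _ = Sig0 := by rw [h1, h2, Matrix.one_mul, Matrix.mul_one]
  have hFt : (forwardMat S0 SN)ᵀ = forwardMat S0 SN := by
    rw [hFD, Matrix.transpose_sub, Matrix.transpose_mul, hsp.transpose_eq, hDp.transpose_eq]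
  refine ⟨q1, ?_, ?_, ?_⟩
  · rw [QMinusInit]
    simp only [Matrix.transpose_mul, ← hT, ← hh, ← hS0, ← hs, hhp.transpose_eq, hsp.transpose_eq,
      Matrix.transpose_nonsing_inv, ← hSN, hFt, Matrix.mul_assoc]
  · rw [← hhT, q3]
    have := hDp.mul_mul_transpose_of_isUnit
      (hhu.mul (Matrix.isUnit_nonsing_inv_iff.2 hsp.isUnit))
    rwa [Matrix.transpose_mul, hhi, transpose_inv_sqrt hS0p] at this
  · rw [hhT, hsig] at q4
    rw [q4, hSN, normCovTerm, ← hT, ← hh, transition_zero_left]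
    generalize (forwardProd A 0 N)⁻¹ * SigN * ((forwardProd A 0 N)⁻¹)ᵀ = W
    calc _ = (h * h⁻¹) * W * (h⁻¹ * h) := by simp only [Matrix.mul_assoc]
      _ = W := by rw [h1, h2, Matrix.one_mul, Matrix.mul_one]

/-- The Riccati variable stays invertible and symmetric, and the precision matrices of the policy
are positive definite. -/
lemma QMinus_properties (hSig0 : Sig0.PosDef) (hSigN : SigN.PosDef)
    (hA : ∀ k < N, IsUnit (A k)) (hG : (ctrlGramian A B N 0).PosDef)
    (hF : IsUnit (forwardMat (normCovInit A B N Sig0) (normCovTerm A B N SigN))) :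
    (∀ k ≤ N, IsUnit (QMinus A B N Sig0 SigN k) ∧
      (QMinus A B N Sig0 SigN k)ᵀ = QMinus A B N Sig0 SigN k) ∧
    ∀ k < N, (precision A B N Sig0 SigN k).PosDef := by
  obtain ⟨q1, q2, q3, -⟩ := QMinusInit_properties hSig0 hSigN hA hG hF
  have hsub : ∀ k ≤ N, IsUnit (QMinusInit A B N Sig0 SigN - ctrlGramian A B k 0) := fun k hk =>
    isUnit_sub_of_posSemidef q1 (posSemidef_ctrlGramian k) hG (posSemidef_ctrlGramian_sub hk) q3
  have hQ : ∀ k ≤ N, IsUnit (QMinus A B N Sig0 SigN k) ∧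
      (QMinus A B N Sig0 SigN k)ᵀ = QMinus A B N Sig0 SigN k := by
    intro k hk
    have hu := isUnit_forwardProd hA k hk
    have hGt : (ctrlGramian A B k 0)ᵀ = ctrlGramian A B k 0 := by
      simpa [Matrix.conjTranspose_eq_transpose_of_trivial] using
        (posSemidef_ctrlGramian (A := A) (B := B) k).isHermitian.eq
    rw [QMinus_eq hA k hk]
    refine ⟨(hu.mul (hsub k hk)).mul ((Matrix.isUnit_transpose _).2 hu), ?_⟩
    simp only [Matrix.transpose_mul, Matrix.transpose_transpose, Matrix.transpose_sub, q2, hGt,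
      Matrix.mul_assoc]
  refine ⟨hQ, fun k hk => ?_⟩
  have hu := isUnit_forwardProd hA (k + 1) hk
  have h1 := Matrix.mul_inv_of_isUnit hu
  set Phi := forwardProd A 0 (k + 1) with hPhi
  set b := Phi⁻¹ * B k with hb
  have hPb : Phi * b = B k := by rw [hb, ← Matrix.mul_assoc, h1, Matrix.one_mul]
  have hgap : (ctrlGramian A B N 0 - ctrlGramian A B k 0 - b * bᵀ).PosSemidef := by
    have := posSemidef_ctrlGramian_sub (A := A) (B := B) (j := k + 1) (k := N) hk
    rwa [ctrlGramian_succ, ← sub_sub] at this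
  have hpos := posDef_one_sub_of_posSemidef q1 q2 (posSemidef_ctrlGramian k) hG hgap q3
    (hsub k hk.le)
  -- Adding `B Bᵀ` undoes the last Riccati step, so the Gramian here is that of time `k`, not `k +
  -- 1`. The remaining gap `G_c(N, 0) - G_c(k, 0)` still dominates `b bᵀ`.
  have hU : QMinus A B N Sig0 SigN (k + 1) + B k * (B k)ᵀ =
      Phi * (QMinusInit A B N Sig0 SigN - ctrlGramian A B k 0) * Phiᵀ := by
    rw [QMinus_eq hA (k + 1) hk, ctrlGramian_succ, ← hPhi, ← hb]
    have : B k * (B k)ᵀ = Phi * (b * bᵀ) * Phiᵀ := by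
      rw [← hPb, Matrix.transpose_mul]; simp only [Matrix.mul_assoc]
    rw [this, ← Matrix.add_mul, ← Matrix.mul_add, ← sub_sub, sub_add_cancel]
  have hUu : IsUnit (QMinus A B N Sig0 SigN (k + 1) + B k * (B k)ᵀ) := by
    rw [hU]
    exact (hu.mul (hsub k hk.le)).mul ((Matrix.isUnit_transpose _).2 hu)
  have hinv := one_sub_mul_precision (hQ (k + 1) hk).1 hUu
  have heq : (B k)ᵀ * (QMinus A B N Sig0 SigN (k + 1) + B k * (B k)ᵀ)⁻¹ * B k =
      bᵀ * (QMinusInit A B N Sig0 SigN - ctrlGramian A B k 0)⁻¹ * b := by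
    rw [hU, Matrix.mul_inv_rev, Matrix.mul_inv_rev, hb, Matrix.transpose_mul,
      Matrix.transpose_nonsing_inv]
    simp only [Matrix.mul_assoc]
  rw [heq] at hinv
  rw [precision, ← Matrix.inv_eq_right_inv hinv]
  exact hpos.inv

/-- The state covariances of the closed-loop system. -/
def closedLoopCov (A : ℕ → Matrix (Fin n) (Fin n) ℝ) (B : ℕ → Matrix (Fin n) (Fin m) ℝ)
    (Sig0 : Matrix (Fin n) (Fin n) ℝ) : ℕ → Matrix (Fin n) (Fin n) ℝ
  | 0 => Sig0
  | k + 1 => A k * closedLoopCov A B Sig0 k * (A k)ᵀ + B k * (B k)ᵀ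

lemma posSemidef_closedLoopCov (hSig0 : Sig0.PosSemidef) :
    ∀ k, (closedLoopCov A B Sig0 k).PosSemidef
  | 0 => hSig0
  | k + 1 => by
    have := (posSemidef_closedLoopCov hSig0 k).mul_mul_conjTranspose_same (A k)
    rw [Matrix.conjTranspose_eq_transpose_of_trivial] at this
    exact this.add (posSemidef_mul_transpose _)

lemma BQ_mul_transpose {k : ℕ} (hM : (precision A B N Sig0 SigN k).PosDef) :
    BQ A B N Sig0 SigN k * (BQ A B N Sig0 SigN k)ᵀ =
      B k * (precision A B N Sig0 SigN k)⁻¹ * (B k)ᵀ := by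
  have : (precision A B N Sig0 SigN k)⁻¹ = (CFC.sqrt (precision A B N Sig0 SigN k))⁻¹ *
      (CFC.sqrt (precision A B N Sig0 SigN k))⁻¹ := by
    rw [← Matrix.mul_inv_rev, CFC.sqrt_mul_sqrt_self _ hM.posSemidef.nonneg]
  rw [BQ, Matrix.transpose_mul, transpose_inv_sqrt hM, this]
  simp only [Matrix.mul_assoc]

lemma QMinus_succ_add (k : ℕ) : QMinus A B N Sig0 SigN (k + 1) + B k * (B k)ᵀ =
    A k * QMinus A B N Sig0 SigN k * (A k)ᵀ := by
  rw [QMinus, sub_add_cancel]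

lemma isUnit_QMinus_succ_add {k : ℕ} (hA : IsUnit (A k))
    (hQ : IsUnit (QMinus A B N Sig0 SigN k)) :
    IsUnit (QMinus A B N Sig0 SigN (k + 1) + B k * (B k)ᵀ) := by
  rw [QMinus_succ_add]
  exact (hA.mul hQ).mul ((Matrix.isUnit_transpose _).2 hA)

/-- The closed-loop system attains the prescribed terminal covariance. -/
lemma closedLoopCov_terminal (hSig0 : Sig0.PosDef) (hSigN : SigN.PosDef)
    (hA : ∀ k < N, IsUnit (A k)) (hG : (ctrlGramian A B N 0).PosDef)
    (hF : IsUnit (forwardMat (normCovInit A B N Sig0) (normCovTerm A B N SigN))) :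
    closedLoopCov (AQ A B N Sig0 SigN) (BQ A B N Sig0 SigN) Sig0 N = SigN := by
  obtain ⟨hQ, hM⟩ := QMinus_properties hSig0 hSigN hA hG hF
  obtain ⟨q1, q2, -, q4⟩ := QMinusInit_properties hSig0 hSigN hA hG hF
  have key : ∀ k ≤ N, (QMinus A B N Sig0 SigN k)⁻¹ *
      closedLoopCov (AQ A B N Sig0 SigN) (BQ A B N Sig0 SigN) Sig0 k *
      (QMinus A B N Sig0 SigN k)⁻¹ - (QMinus A B N Sig0 SigN k)⁻¹ =
      ((forwardProd A 0 k)⁻¹)ᵀ * ((QMinusInit A B N Sig0 SigN)⁻¹ * Sig0 *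
      (QMinusInit A B N Sig0 SigN)⁻¹ - (QMinusInit A B N Sig0 SigN)⁻¹) *
      (forwardProd A 0 k)⁻¹ := by
    intro k
    induction k with
    | zero => intro _; simp [QMinus, forwardProd, closedLoopCov]
    | succ k ih =>
      intro hk
      have hk' : k < N := hk
      have h := covariance_recursion (hA k hk') (hQ (k + 1) hk).1
        (isUnit_QMinus_succ_add (hA k hk') (hQ k hk'.le).1) (hQ k hk'.le).2 (hQ (k + 1) hk).2
        (QMinus_succ_add k) (closedLoopCov (AQ A B N Sig0 SigN) (BQ A B N Sig0 SigN) Sig0 k)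
      rw [ih hk'.le] at h
      rw [closedLoopCov, BQ_mul_transpose (hM k hk')]
      refine h.trans ?_
      rw [forwardProd, zero_add, Matrix.mul_inv_rev, Matrix.transpose_mul]
      simp only [Matrix.mul_assoc]
  have h := key N le_rfl
  have hu := isUnit_forwardProd hA N le_rfl
  set Q := QMinus A B N Sig0 SigN N with hQdef
  set Phi := forwardProd A 0 N with hPhi
  set K := QMinusInit A B N Sig0 SigN - ctrlGramian A B N 0 with hK
  have hQK : Q = Phi * K * Phiᵀ := QMinus_eq hA N le_rfl
  have hQ1 := Matrix.mul_inv_of_isUnit (hQ N le_rfl).1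
  have hQ2 := Matrix.inv_mul_of_isUnit (hQ N le_rfl).1
  have hP1 := Matrix.mul_inv_of_isUnit hu
  have hP2 := Matrix.inv_mul_of_isUnit hu
  have hP1t : (Phi⁻¹)ᵀ * Phiᵀ = 1 := by rw [← Matrix.transpose_mul, hP1, Matrix.transpose_one]
  have hP2t : Phiᵀ * (Phi⁻¹)ᵀ = 1 := by rw [← Matrix.transpose_mul, hP2, Matrix.transpose_one]
  set Sg := closedLoopCov (AQ A B N Sig0 SigN) (BQ A B N Sig0 SigN) Sig0 N with hSg
  -- The transported quantity at time `N` is solved for the covariance. Since `Q = Φ K Φᵀ`, the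
  -- factors `Φ⁻¹` cancel and the left side of `q4` appears.
  calc Sg = (Q * Q⁻¹) * Sg * (Q⁻¹ * Q) := by rw [hQ1, hQ2, Matrix.one_mul, Matrix.mul_one]
    _ = Q + Q * (Q⁻¹ * Sg * Q⁻¹ - Q⁻¹) * Q := by
      have hQ1' (x : Matrix (Fin n) (Fin n) ℝ) : Q * (Q⁻¹ * x) = x := by
        rw [← Matrix.mul_assoc, hQ1, Matrix.one_mul]
      simp only [Matrix.mul_sub, Matrix.sub_mul, Matrix.mul_assoc, hQ1',
        add_sub_cancel]
    _ = Phi * (K + K * ((QMinusInit A B N Sig0 SigN)⁻¹ * Sig0 * (QMinusInit A B N Sig0 SigN)⁻¹ -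
          (QMinusInit A B N Sig0 SigN)⁻¹) * K) * Phiᵀ := by
      rw [h, hQK, Matrix.mul_add, Matrix.add_mul]
      congr 1
      generalize (QMinusInit A B N Sig0 SigN)⁻¹ * Sig0 * (QMinusInit A B N Sig0 SigN)⁻¹ -
          (QMinusInit A B N Sig0 SigN)⁻¹ = E
      calc _ = Phi * K * (Phiᵀ * (Phi⁻¹)ᵀ) * E * (Phi⁻¹ * Phi) * K * Phiᵀ := by
            simp only [Matrix.mul_assoc]
        _ = _ := by rw [hP2, hP2t]; simp only [Matrix.mul_assoc, Matrix.one_mul]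
    _ = (Phi * Phi⁻¹) * SigN * ((Phi⁻¹)ᵀ * Phiᵀ) := by
      rw [q4]; simp only [Matrix.mul_assoc]
    _ = SigN := by rw [hP1, hP1t, Matrix.one_mul, Matrix.mul_one]

end Dynamics

/-! ### Quadratic forms and affine images of Gaussian measures -/

section GaussianLemmas

variable {n m : ℕ}

@[fun_prop]
lemma continuous_toEuclideanLin (C : Matrix (Fin n) (Fin m) ℝ) :
    Continuous (Matrix.toEuclideanLin C) :=
  LinearMap.continuous_of_finiteDimensional _

@[fun_prop]
lemma measurable_toEuclideanLin (C : Matrix (Fin n) (Fin m) ℝ) :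
    Measurable (Matrix.toEuclideanLin C) :=
  (continuous_toEuclideanLin C).measurable

/-- The quadratic form `xᵀ S x`. -/
def quadForm (S : Matrix (Fin n) (Fin n) ℝ) (x : EuclideanSpace ℝ (Fin n)) : ℝ :=
  x.ofLp ⬝ᵥ S *ᵥ x.ofLp

lemma quadForm_eq_inner (S : Matrix (Fin n) (Fin n) ℝ) (x : EuclideanSpace ℝ (Fin n)) :
    quadForm S x = inner ℝ x (Matrix.toEuclideanCLM (𝕜 := ℝ) S x) :=
  (Matrix.inner_toEuclideanCLM S x x).symm

@[fun_prop]
lemma continuous_quadForm (S : Matrix (Fin n) (Fin n) ℝ) : Continuous (quadForm S) := by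
  have : quadForm S = fun x => inner ℝ x (Matrix.toEuclideanCLM (𝕜 := ℝ) S x) :=
    funext (quadForm_eq_inner S)
  rw [this]
  fun_prop

@[fun_prop]
lemma measurable_quadForm (S : Matrix (Fin n) (Fin n) ℝ) : Measurable (quadForm S) :=
  (continuous_quadForm S).measurable

lemma integrable_quadForm (S : Matrix (Fin n) (Fin n) ℝ) (μ : Measure (EuclideanSpace ℝ (Fin n)))
    [IsGaussian μ] : Integrable (quadForm S) μ := by
  have h2 : Integrable (fun x : EuclideanSpace ℝ (Fin n) => ‖x‖ ^ 2) μ :=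
    (IsGaussian.memLp_two_id (μ := μ)).integrable_norm_pow two_ne_zero
  refine (h2.const_mul ‖Matrix.toEuclideanCLM (𝕜 := ℝ) S‖).mono'
    (measurable_quadForm S).aestronglyMeasurable (Filter.Eventually.of_forall fun x => ?_)
  rw [quadForm_eq_inner]
  calc ‖inner ℝ x (Matrix.toEuclideanCLM (𝕜 := ℝ) S x)‖
      ≤ ‖x‖ * ‖Matrix.toEuclideanCLM (𝕜 := ℝ) S x‖ := norm_inner_le_norm _ _
    _ ≤ ‖x‖ * (‖Matrix.toEuclideanCLM (𝕜 := ℝ) S‖ * ‖x‖) := by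
        gcongr; exact ContinuousLinearMap.le_opNorm _ _
    _ = _ := by ring

lemma inner_toEuclideanLin (C : Matrix (Fin n) (Fin m) ℝ) (x : EuclideanSpace ℝ (Fin m))
    (t : EuclideanSpace ℝ (Fin n)) :
    inner ℝ (Matrix.toEuclideanLin C x) t = inner ℝ x (Matrix.toEuclideanLin Cᵀ t) := by
  simp only [EuclideanSpace.inner_eq_star_dotProduct, Matrix.ofLp_toLpLin, Matrix.toLin'_apply,
    star_trivial]
  rw [Matrix.dotProduct_mulVec, ← Matrix.mulVec_transpose]

lemma charFun_map_toEuclideanLin (C : Matrix (Fin n) (Fin m) ℝ)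
    (μ : Measure (EuclideanSpace ℝ (Fin m))) (t : EuclideanSpace ℝ (Fin n)) :
    charFun (μ.map (Matrix.toEuclideanLin C)) t = charFun μ (Matrix.toEuclideanLin Cᵀ t) := by
  rw [charFun_apply, charFun_apply, integral_map (by fun_prop) (by fun_prop)]
  simp only [inner_toEuclideanLin]

/-- A linear combination of independent centred Gaussian vectors is Gaussian. -/
lemma map_add_multivariateGaussian {A S : Matrix (Fin n) (Fin n) ℝ} {B : Matrix (Fin n) (Fin m) ℝ}
    (hS : S.PosSemidef) :
    ((multivariateGaussian 0 S).prod (stdGaussian (EuclideanSpace ℝ (Fin m)))).map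
      (fun p => Matrix.toEuclideanLin A p.1 + Matrix.toEuclideanLin B p.2) =
      multivariateGaussian 0 (A * S * Aᵀ + B * Bᵀ) := by
  have hS' : (A * S * Aᵀ + B * Bᵀ).PosSemidef := by
    have := hS.mul_mul_conjTranspose_same A
    rw [Matrix.conjTranspose_eq_transpose_of_trivial] at this
    exact this.add (posSemidef_mul_transpose B)
  -- The image covariances may be singular, so the laws are compared through characteristic
  -- functions rather than densities.
  have h : ((multivariateGaussian 0 S).prod (stdGaussian (EuclideanSpace ℝ (Fin m)))).map
      (fun p => Matrix.toEuclideanLin A p.1 + Matrix.toEuclideanLin B p.2) =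
      ((multivariateGaussian 0 S).map (Matrix.toEuclideanLin A)) ∗
        ((stdGaussian (EuclideanSpace ℝ (Fin m))).map (Matrix.toEuclideanLin B)) := by
    rw [Measure.conv, Measure.map_prod_map _ _ (by fun_prop) (by fun_prop),
      Measure.map_map (by fun_prop) (by fun_prop)]
    rfl
  rw [h]
  have := Measure.isProbabilityMeasure_map (μ := multivariateGaussian 0 S)
    (measurable_toEuclideanLin A).aemeasurable
  have := Measure.isProbabilityMeasure_map (μ := stdGaussian (EuclideanSpace ℝ (Fin m)))
    (measurable_toEuclideanLin B).aemeasurable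
  apply Measure.ext_of_charFun
  ext t
  rw [charFun_conv, charFun_map_toEuclideanLin, charFun_map_toEuclideanLin,
    charFun_multivariateGaussian hS, charFun_multivariateGaussian hS', charFun_stdGaussian,
    ← Complex.exp_add]
  congr 1
  have h1 : t.ofLp ⬝ᵥ (A * S * Aᵀ + B * Bᵀ) *ᵥ t.ofLp =
      (Aᵀ *ᵥ t.ofLp) ⬝ᵥ S *ᵥ (Aᵀ *ᵥ t.ofLp) + (Bᵀ *ᵥ t.ofLp) ⬝ᵥ (Bᵀ *ᵥ t.ofLp) := by
    rw [Matrix.add_mulVec, dotProduct_add, Matrix.mul_assoc, ← Matrix.mulVec_mulVec,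
      ← Matrix.mulVec_mulVec, ← Matrix.mulVec_mulVec, Matrix.dotProduct_mulVec _ A,
      Matrix.dotProduct_mulVec _ B, ← Matrix.mulVec_transpose, ← Matrix.mulVec_transpose]
  have h2 : ‖Matrix.toEuclideanLin Bᵀ t‖ ^ 2 = (Bᵀ *ᵥ t.ofLp) ⬝ᵥ (Bᵀ *ᵥ t.ofLp) := by
    rw [← real_inner_self_eq_norm_sq, EuclideanSpace.inner_eq_star_dotProduct]
    simp
  rw [h1, ← Complex.ofReal_pow, h2]
  simp only [Matrix.ofLp_toLpLin, Matrix.toLin'_apply, inner_zero_right]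
  push_cast
  ring

/-- The standard Gaussian measure has a density proportional to `exp (-‖w‖² / 2)`. -/
lemma exists_stdGaussian_eq_smul_withDensity :
    ∃ c : ENNReal, stdGaussian (EuclideanSpace ℝ (Fin m)) =
      c • volume.withDensity fun w => ENNReal.ofReal (Real.exp (-(1 / 2) * ‖w‖ ^ 2)) := by
  set E := EuclideanSpace ℝ (Fin m)
  set g : E → ℝ := fun w => Real.exp (-(1 / 2) * ‖w‖ ^ 2) with hg
  have hgm : Measurable g := by fun_prop
  have hcplx (t : E) := GaussianFourier.integral_cexp_neg_mul_sq_norm_add (V := E)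
    (b := (1 / 2 : ℂ)) (by norm_num) Complex.I t
  set Z : ℂ := (Real.pi / (1 / 2 : ℂ)) ^ ((Module.finrank ℝ E : ℂ) / 2) with hZ
  have hZ0 : Z ≠ 0 := by
    rw [hZ, Ne, Complex.cpow_eq_zero_iff]
    simp [Real.pi_ne_zero]
  have hint : Integrable g := by
    have h := GaussianFourier.integrable_cexp_neg_mul_sq_norm_add (V := E)
      (b := (1 / 2 : ℂ)) (by norm_num) 0 0
    refine h.norm.congr (Filter.Eventually.of_forall fun w => ?_)
    simp only [Complex.norm_exp, hg]
    congr 1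
    simp [← Complex.ofReal_pow]
  have hfin : IsFiniteMeasure (volume.withDensity fun w : E => ENNReal.ofReal (g w)) :=
    isFiniteMeasure_withDensity_ofReal hint.2
  have hcf (t : E) : charFun (volume.withDensity fun w : E => ENNReal.ofReal (g w)) t =
      Z * charFun (stdGaussian E) t := by
    rw [charFun_apply, integral_withDensity_eq_integral_toReal_smul (by fun_prop)
      (Filter.Eventually.of_forall fun _ => ENNReal.ofReal_lt_top), charFun_stdGaussian]
    have h := hcplx t
    rw [show (Complex.I ^ 2 * (‖t‖ : ℂ) ^ 2 / (4 * (1 / 2)) : ℂ) = -(‖t‖ : ℂ) ^ 2 / 2 by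
      rw [Complex.I_sq]; ring] at h
    rw [← h]
    refine integral_congr_ae (Filter.Eventually.of_forall fun w => ?_)
    simp only [hg]
    rw [ENNReal.toReal_ofReal (Real.exp_pos _).le, Complex.real_smul, Complex.ofReal_exp,
      ← Complex.exp_add, real_inner_comm]
    push_cast
    congr 1
    ring
  set z : ℝ := ∫ w, g w with hz
  have hzZ : Z = (z : ℂ) := by
    -- At `t = 0` the complex Fourier constant is identified with the total mass, which is real and
    -- positive.
    have h0 := hcf 0
    simp only [charFun_zero, Measure.real, measure_univ, ENNReal.toReal_one, Complex.ofReal_one,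
      mul_one] at h0
    rw [← h0, withDensity_apply _ MeasurableSet.univ, Measure.restrict_univ, hz,
      integral_eq_lintegral_of_nonneg_ae (Filter.Eventually.of_forall fun _ => (Real.exp_pos _).le)
        hgm.aestronglyMeasurable]
  have hzpos : 0 < z := integral_exp_pos hint
  refine ⟨(ENNReal.ofReal z)⁻¹, ?_⟩
  have key : ENNReal.ofReal z • stdGaussian E =
      volume.withDensity fun w : E => ENNReal.ofReal (g w) := by
    have : IsFiniteMeasure (ENNReal.ofReal z • stdGaussian E) :=
      Measure.smul_finite _ ENNReal.ofReal_ne_top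
    apply Measure.ext_of_charFun
    ext t
    rw [hcf, hzZ, charFun_apply, integral_smul_measure, ENNReal.toReal_ofReal hzpos.le,
      charFun_apply, Complex.real_smul]
  rw [← key, smul_smul, ENNReal.inv_mul_cancel (by simpa using hzpos) ENNReal.ofReal_ne_top,
    one_smul]

/-- An affine image of the standard Gaussian measure, as a reweighting of it. The constant does not
depend on the translation. -/
lemma exists_lintegral_affine_stdGaussian {M : Matrix (Fin m) (Fin m) ℝ} (hM : M.PosDef) :
    ∃ c : ENNReal, ∀ (d : EuclideanSpace ℝ (Fin m)) (f : EuclideanSpace ℝ (Fin m) → ENNReal),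
      Measurable f →
      ∫⁻ w, f (Matrix.toEuclideanLin (CFC.sqrt M)⁻¹ w - d) ∂stdGaussian (EuclideanSpace ℝ (Fin m)) =
        c * ∫⁻ u, ENNReal.ofReal (Real.exp (1 / 2 * ‖u‖ ^ 2 - 1 / 2 * quadForm M (u + d))) * f u
          ∂stdGaussian (EuclideanSpace ℝ (Fin m)) := by
  set E := EuclideanSpace ℝ (Fin m)
  obtain ⟨a, ha⟩ := exists_stdGaussian_eq_smul_withDensity (m := m)
  have hR := hM.sqrt_posDef
  set R := CFC.sqrt M with hRdef
  have hRR : R * R = M := CFC.sqrt_mul_sqrt_self M hM.posSemidef.nonneg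
  have hRi : IsUnit R⁻¹ := Matrix.isUnit_nonsing_inv_iff.2 hR.isUnit
  have hdet : LinearMap.det (Matrix.toEuclideanLin R⁻¹) ≠ 0 := by
    rw [LinearMap.det_toLpLin]
    exact ((Matrix.isUnit_iff_isUnit_det _).1 hRi).ne_zero
  set b := ENNReal.ofReal |(LinearMap.det (Matrix.toEuclideanLin R⁻¹))⁻¹| with hb
  -- Translation invariance leaves only the Jacobian of `M^{-1/2}`. The shift `d` will be the state
  -- feedback `K x`, so a constant depending on `d` could not be taken out of the integral over the
  -- state.
  have hvol (F : E → ENNReal) (hF : Measurable F) (d : E) :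
      ∫⁻ w, F (Matrix.toEuclideanLin R⁻¹ w - d) = b * ∫⁻ u, F u := by
    have h1 : ∫⁻ w : E, F (Matrix.toEuclideanLin R⁻¹ w - d) =
        ∫⁻ v, F (v - d) ∂(volume.map (Matrix.toEuclideanLin R⁻¹)) := by
      rw [lintegral_map (by fun_prop) (by fun_prop)]
    rw [h1, Measure.map_linearMap_addHaar_eq_smul_addHaar _ hdet, lintegral_smul_measure,
      lintegral_sub_right_eq_self]
    rfl
  refine ⟨b, fun d f hf => ?_⟩
  have hnorm (w : E) : ‖w‖ ^ 2 = quadForm M ((Matrix.toEuclideanLin R⁻¹ w - d) + d) := by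
    rw [sub_add_cancel, ← real_inner_self_eq_norm_sq, EuclideanSpace.inner_eq_star_dotProduct,
      quadForm, Matrix.ofLp_toLpLin, Matrix.toLin'_apply, star_trivial, Matrix.mulVec_mulVec, ← hRR,
      Matrix.mul_assoc, Matrix.mul_inv_of_isUnit hR.isUnit, Matrix.mul_one,
      Matrix.dotProduct_mulVec, ← Matrix.mulVec_transpose, hR.transpose_eq, Matrix.mulVec_mulVec,
      Matrix.mul_inv_of_isUnit hR.isUnit, Matrix.one_mulVec]
  rw [ha, lintegral_smul_measure, lintegral_smul_measure,
    lintegral_withDensity_eq_lintegral_mul _ (by fun_prop) (by fun_prop),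
    lintegral_withDensity_eq_lintegral_mul _ (by fun_prop) (by fun_prop)]
  have h1 : (∫⁻ w : E, ((fun w : E => ENNReal.ofReal (Real.exp (-(1 / 2) * ‖w‖ ^ 2))) *
      fun w => f (Matrix.toEuclideanLin R⁻¹ w - d)) w) =
      ∫⁻ w : E, (fun u => ENNReal.ofReal (Real.exp (-(1 / 2) * quadForm M (u + d))) * f u)
        (Matrix.toEuclideanLin R⁻¹ w - d) := by
    refine lintegral_congr fun w => ?_
    simp only [Pi.mul_apply]
    rw [hnorm w]
  have h2 : Measurable fun u : E =>
      ENNReal.ofReal (Real.exp (-(1 / 2) * quadForm M (u + d))) * f u := by fun_prop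
  rw [h1.trans (hvol _ h2 d), smul_eq_mul, smul_eq_mul, mul_left_comm]
  congr 2
  refine lintegral_congr fun u => ?_
  simp only [Pi.mul_apply]
  rw [← mul_assoc, ← ENNReal.ofReal_mul (Real.exp_pos _).le, ← Real.exp_add]
  congr 3
  ring_nf

end GaussianLemmas

/-! ### The Pythagorean identity for exponential tilts -/

section EntropyLemma

variable {α : Type*} [MeasurableSpace α]

/-- The divergence from `ν` splits off the divergence from an exponential tilt of `ν`. -/
lemma klDiv_eq_klDiv_tilted_add {ν μ : Measure α} [IsProbabilityMeasure ν]
    [IsProbabilityMeasure μ] {f : α → ℝ} (hR : Integrable (fun x => Real.exp (f x)) ν)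
    (hfS : Integrable f (ν.tilted f)) (hfP : Integrable f μ)
    (hPS : ∫ x, f x ∂μ = ∫ x, f x ∂(ν.tilted f)) (htop : klDiv μ ν ≠ ⊤) :
    klDiv (ν.tilted f) ν ≠ ⊤ ∧
      klDiv μ ν = klDiv μ (ν.tilted f) + klDiv (ν.tilted f) ν := by
  have hS := isProbabilityMeasure_tilted hR
  have hSR : ν.tilted f ≪ ν := tilted_absolutelyContinuous ν f
  have hRS : ν ≪ ν.tilted f := absolutelyContinuous_tilted hR
  obtain ⟨hac, hint⟩ := klDiv_ne_top_iff.1 htop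
  have hllr : llr (ν.tilted f) ν =ᵐ[ν.tilted f]
      fun x => f x - Real.log (∫ x, Real.exp (f x) ∂ν) :=
    hSR.ae_le (log_rnDeriv_tilted_left_self hR)
  have hSint : Integrable (llr (ν.tilted f) ν) (ν.tilted f) :=
    (integrable_congr hllr).2 (hfS.sub (integrable_const _))
  have hSne := klDiv_ne_top hSR hSint
  have hPSac := hac.trans hRS
  have hPne := klDiv_ne_top hPSac (integrable_llr_tilted_right hac hfP hint hR)
  refine ⟨hSne, ?_⟩
  -- All three divergences being finite, the identity is one between real integrals: `log dμ/dν` is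
  -- `log dμ/d(ν.tilted f)` plus `f - log Z`, and the `μ`-integral of the latter equals its integral
  -- under the tilt by `hPS`.
  rw [← ENNReal.toReal_eq_toReal_iff' htop (ENNReal.add_ne_top.2 ⟨hPne, hSne⟩),
    ENNReal.toReal_add hPne hSne, toReal_klDiv_of_measure_eq hac (by simp),
    toReal_klDiv_of_measure_eq hPSac (by simp), toReal_klDiv_of_measure_eq hSR (by simp),
    integral_llr_tilted_right hac hfP hR hint, integral_congr_ae hllr,
    integral_sub hfS (integrable_const _), hPS]
  simp

end EntropyLemma

/-! ### Path laws built one time step at a time -/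

section PathLaw

variable {n m : ℕ}

lemma statePath_zero {N : ℕ} (A : ℕ → Matrix (Fin n) (Fin n) ℝ) (B : ℕ → Matrix (Fin n) (Fin m) ℝ)
    (x0 : EuclideanSpace ℝ (Fin n)) (w : Fin N → EuclideanSpace ℝ (Fin m)) :
    statePath A B x0 w 0 = x0 := rfl

lemma statePath_succ {N : ℕ} (A : ℕ → Matrix (Fin n) (Fin n) ℝ)
    (B : ℕ → Matrix (Fin n) (Fin m) ℝ) (x0 : EuclideanSpace ℝ (Fin n))
    (w : Fin N → EuclideanSpace ℝ (Fin m)) (i : Fin N) :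
    statePath A B x0 w i.succ = Matrix.toEuclideanLin (A i) (statePath A B x0 w i.castSucc) +
      Matrix.toEuclideanLin (B i) (w i) :=
  Fin.induction_succ _ _ _

lemma measurable_statePath (N : ℕ) (A : ℕ → Matrix (Fin n) (Fin n) ℝ)
    (B : ℕ → Matrix (Fin n) (Fin m) ℝ) :
    Measurable fun p : EuclideanSpace ℝ (Fin n) × (Fin N → EuclideanSpace ℝ (Fin m)) =>
      statePath A B p.1 p.2 := by
  refine measurable_pi_iff.2 fun k => ?_
  induction k using Fin.induction with
  | zero => simpa only [statePath_zero] using measurable_fst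
  | succ i ih => simp only [statePath_succ]; fun_prop

/-- The last noise value affects the last state only. This causality allows path laws to be treated
by induction on the horizon. -/
lemma statePath_snoc {N : ℕ} (A : ℕ → Matrix (Fin n) (Fin n) ℝ) (B : ℕ → Matrix (Fin n) (Fin m) ℝ)
    (x0 : EuclideanSpace ℝ (Fin n)) (w : Fin N → EuclideanSpace ℝ (Fin m))
    (v : EuclideanSpace ℝ (Fin m)) :
    statePath A B x0 (Fin.snoc (α := fun _ => EuclideanSpace ℝ (Fin m)) w v) =
      Fin.snoc (α := fun _ => EuclideanSpace ℝ (Fin n)) (statePath A B x0 w)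
        (Matrix.toEuclideanLin (A N) (statePath A B x0 w (Fin.last N)) +
          Matrix.toEuclideanLin (B N) v) := by
  have h : ∀ k : Fin (N + 1),
      statePath A B x0 (Fin.snoc (α := fun _ => EuclideanSpace ℝ (Fin m)) w v) k.castSucc =
        statePath A B x0 w k := by
    intro k
    induction k using Fin.induction with
    | zero => rfl
    | succ i ih =>
      rw [← Fin.succ_castSucc, statePath_succ, ih, statePath_succ, Fin.snoc_castSucc]
      simp
  ext1 k
  induction k using Fin.lastCases with
  | last =>
    rw [Fin.snoc_last, ← Fin.succ_last, statePath_succ, h]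
    simp
  | cast k => rw [h, Fin.snoc_castSucc]

lemma measurable_snoc {E : Type*} [MeasurableSpace E] (N : ℕ) :
    Measurable fun p : (Fin N → E) × E => Fin.snoc (α := fun _ => E) p.1 p.2 := by
  refine measurable_pi_iff.2 fun k => ?_
  induction k using Fin.lastCases with
  | last => simpa only [Fin.snoc_last] using measurable_snd
  | cast k => simp only [Fin.snoc_castSucc]; fun_prop

lemma lintegral_pi_snoc {E : Type*} [MeasurableSpace E] (N : ℕ) (μ : Measure E)
    [IsProbabilityMeasure μ] {f : (Fin (N + 1) → E) → ENNReal} (hf : Measurable f) :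
    ∫⁻ w, f w ∂(Measure.pi fun _ : Fin (N + 1) => μ) =
      ∫⁻ w, ∫⁻ v, f (Fin.snoc (α := fun _ => E) w v) ∂μ ∂(Measure.pi fun _ : Fin N => μ) := by
  have h := (measurePreserving_piFinSuccAbove (fun _ : Fin (N + 1) => μ) (Fin.last N)).symm
  rw [← h.lintegral_comp hf, lintegral_prod_symm _ (by fun_prop)]
  refine lintegral_congr fun w => lintegral_congr fun v => ?_
  congr 1
  exact Fin.insertNth_last' v w

instance isProbabilityMeasure_pathLaw (N : ℕ) (A : ℕ → Matrix (Fin n) (Fin n) ℝ)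
    (B : ℕ → Matrix (Fin n) (Fin m) ℝ) (S : Matrix (Fin n) (Fin n) ℝ) :
    IsProbabilityMeasure (pathLaw N A B S) :=
  Measure.isProbabilityMeasure_map (measurable_statePath N A B).aemeasurable

/-- The path law on one more time step is obtained by appending a state. -/
lemma lintegral_pathLaw_succ (N : ℕ) (A : ℕ → Matrix (Fin n) (Fin n) ℝ)
    (B : ℕ → Matrix (Fin n) (Fin m) ℝ) (S : Matrix (Fin n) (Fin n) ℝ)
    {f : (Fin (N + 2) → EuclideanSpace ℝ (Fin n)) → ENNReal} (hf : Measurable f) :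
    ∫⁻ x, f x ∂pathLaw (N + 1) A B S =
      ∫⁻ x, ∫⁻ v, f (Fin.snoc (α := fun _ => EuclideanSpace ℝ (Fin n)) x
        (Matrix.toEuclideanLin (A N) (x (Fin.last N)) + Matrix.toEuclideanLin (B N) v))
        ∂stdGaussian (EuclideanSpace ℝ (Fin m)) ∂pathLaw N A B S := by
  have hm := measurable_statePath N A B
  have hm' := measurable_statePath (N + 1) A B
  have hs := measurable_snoc (E := EuclideanSpace ℝ (Fin n)) (N + 1)
  have hg : Measurable fun p : (Fin (N + 1) → EuclideanSpace ℝ (Fin n)) ×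
      EuclideanSpace ℝ (Fin m) => f (Fin.snoc (α := fun _ => EuclideanSpace ℝ (Fin n)) p.1
        (Matrix.toEuclideanLin (A N) (p.1 (Fin.last N)) + Matrix.toEuclideanLin (B N) p.2)) :=
    hf.comp (hs.comp (measurable_fst.prodMk (by fun_prop)))
  have hg' := hg.lintegral_prod_right' (ν := stdGaussian (EuclideanSpace ℝ (Fin m)))
  have e1 := (lintegral_map (μ := (multivariateGaussian 0 S).prod
    (Measure.pi fun _ : Fin (N + 1) => multivariateGaussian 0 1)) hf hm').trans
    (lintegral_prod _ (hf.comp hm').aemeasurable)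
  have e2 := (lintegral_map (μ := (multivariateGaussian 0 S).prod
    (Measure.pi fun _ : Fin N => multivariateGaussian 0 1)) hg' hm).trans
    (lintegral_prod _ (hg'.comp hm).aemeasurable)
  refine e1.trans (Eq.trans ?_ e2.symm)
  refine lintegral_congr fun x0 => ?_
  refine (lintegral_pi_snoc N (multivariateGaussian 0 1)
    (hf.comp (hm'.comp measurable_prodMk_left))).trans ?_
  rw [multivariateGaussian_zero_one]
  refine lintegral_congr fun w => lintegral_congr fun v => ?_
  simp only [Function.comp_apply, statePath_snoc]

lemma map_zero_pathLaw (N : ℕ) (A : ℕ → Matrix (Fin n) (Fin n) ℝ)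
    (B : ℕ → Matrix (Fin n) (Fin m) ℝ) (S : Matrix (Fin n) (Fin n) ℝ) :
    (pathLaw N A B S).map (fun x => x 0) = multivariateGaussian 0 S := by
  rw [pathLaw, Measure.map_map (by fun_prop) (measurable_statePath N A B)]
  exact Measure.map_fst_prod.trans (by simp)

/-- The new state is a linear function of the previous one and an independent noise, so Gaussianity
propagates with the covariance recursion. -/
lemma map_last_pathLaw (A : ℕ → Matrix (Fin n) (Fin n) ℝ)
    (B : ℕ → Matrix (Fin n) (Fin m) ℝ) {S : Matrix (Fin n) (Fin n) ℝ} (hS : S.PosSemidef) (N : ℕ) :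
    (pathLaw N A B S).map (fun x => x (Fin.last N)) =
      multivariateGaussian 0 (closedLoopCov A B S N) := by
  induction N with
  | zero => exact map_zero_pathLaw 0 A B S
  | succ N ih =>
    refine Measure.ext_of_lintegral _ fun f hf => ?_
    have hg : Measurable fun p : EuclideanSpace ℝ (Fin n) × EuclideanSpace ℝ (Fin m) =>
        f (Matrix.toEuclideanLin (A N) p.1 + Matrix.toEuclideanLin (B N) p.2) := by fun_prop
    rw [lintegral_map hf (by fun_prop), lintegral_pathLaw_succ N A B S (by fun_prop),
      closedLoopCov, ← map_add_multivariateGaussian (posSemidef_closedLoopCov hS N),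
      lintegral_map hf (by fun_prop), lintegral_prod _ hg.aemeasurable, ← ih,
      lintegral_map hg.lintegral_prod_right' (by fun_prop)]
    simp only [Fin.snoc_last]

end PathLaw

/-! ### The closed-loop law as an endpoint tilt of the reference law -/

section Tilt

/-- Composition of a reweighting of the law of the past with a reweighting of the next step. -/
lemma lintegral_two_step_reweight {X U : Type*} [MeasurableSpace X] [MeasurableSpace U]
    {μ ν : Measure X} {γ : Measure U} [SFinite γ] {c1 c2 : ENNReal} {D F : X → ENNReal}
    {G : X × U → ENNReal}
    (hμ : ∀ g : X → ENNReal, Measurable g → ∫⁻ x, g x ∂μ = c1 * ∫⁻ x, D x * g x ∂ν)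
    (hG : Measurable G) (hF : ∀ x, F x = c2 * ∫⁻ u, G (x, u) ∂γ) :
    ∫⁻ x, F x ∂μ = c1 * c2 * ∫⁻ x, ∫⁻ u, D x * G (x, u) ∂γ ∂ν := by
  have hGm : Measurable fun x => ∫⁻ u, G (x, u) ∂γ := hG.lintegral_prod_right'
  have h (x : X) : ∫⁻ u, D x * G (x, u) ∂γ = D x * ∫⁻ u, G (x, u) ∂γ :=
    lintegral_const_mul _ (hG.comp measurable_prodMk_left)
  simp only [hF, h]
  rw [lintegral_const_mul _ hGm, hμ _ hGm]
  ring

variable {n m N : ℕ} {A : ℕ → Matrix (Fin n) (Fin n) ℝ} {B : ℕ → Matrix (Fin n) (Fin m) ℝ}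
  {Sig0 SigN : Matrix (Fin n) (Fin n) ℝ}

lemma norm_sq_eq_dotProduct (u : EuclideanSpace ℝ (Fin m)) : ‖u‖ ^ 2 = u.ofLp ⬝ᵥ u.ofLp := by
  rw [← real_inner_self_eq_norm_sq, EuclideanSpace.inner_eq_star_dotProduct, star_trivial]

/-- Completing the square: the log-likelihood ratio of the optimal policy with respect to the
standard Gaussian noise is a difference of values of quadratic forms along the trajectory. -/
lemma norm_sq_sub_quadForm_precision {A Q Q' : Matrix (Fin n) (Fin n) ℝ}
    {B : Matrix (Fin n) (Fin m) ℝ} (hQ' : IsUnit Q') (hQs' : Q'ᵀ = Q')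
    (hA : IsUnit A) (hU : IsUnit (Q' + B * Bᵀ)) (h : Q' + B * Bᵀ = A * Q * Aᵀ)
    (hM : (1 + Bᵀ * Q'⁻¹ * B).PosDef)
    (x : EuclideanSpace ℝ (Fin n)) (u : EuclideanSpace ℝ (Fin m)) :
    ‖u‖ ^ 2 - quadForm (1 + Bᵀ * Q'⁻¹ * B)
      (u + Matrix.toEuclideanLin ((1 + Bᵀ * Q'⁻¹ * B)⁻¹ * Bᵀ * Q'⁻¹ * A) x) =
    quadForm Q⁻¹ x - quadForm Q'⁻¹ (Matrix.toEuclideanLin A x + Matrix.toEuclideanLin B u) := by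
  have hM1 := Matrix.mul_inv_of_isUnit hM.isUnit
  have hMt := hM.transpose_eq
  -- This removes `Q`: both sides become quadratic in `(x, u)` with coefficients built from `A`,
  -- `B`, `P = Q'⁻¹` and `M⁻¹`, and can be compared term by term.
  rw [← value_recursion hA hQ' hU h]
  generalize hMdef : 1 + Bᵀ * Q'⁻¹ * B = M at *
  have hPt : (Q'⁻¹)ᵀ = Q'⁻¹ := by rw [Matrix.transpose_nonsing_inv, hQs']
  generalize Q'⁻¹ = P at *
  have hMit : (M⁻¹)ᵀ = M⁻¹ := by rw [Matrix.transpose_nonsing_inv, hMt]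
  have hMM' : M * (M⁻¹ * Bᵀ * P * A) = Bᵀ * P * A := by
    simp only [Matrix.mul_assoc]; rw [← Matrix.mul_assoc M, hM1, Matrix.one_mul]
  set K := M⁻¹ * Bᵀ * P * A with hK
  have hKt : Kᵀ = Aᵀ * P * B * M⁻¹ := by
    simp only [hK, Matrix.transpose_mul, Matrix.transpose_transpose, hPt, hMit, Matrix.mul_assoc]
  rw [norm_sq_eq_dotProduct]
  simp only [quadForm, WithLp.ofLp_add, Matrix.ofLp_toLpLin, Matrix.toLin'_apply]
  generalize x.ofLp = x
  generalize u.ofLp = u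
  have adj {p q : ℕ} (C : Matrix (Fin p) (Fin q) ℝ) (y : Fin q → ℝ) (z : Fin p → ℝ) :
      (C *ᵥ y) ⬝ᵥ z = y ⬝ᵥ Cᵀ *ᵥ z := by
    rw [Matrix.dotProduct_mulVec, ← Matrix.mulVec_transpose, Matrix.transpose_transpose]
  have e1 : (u + K *ᵥ x) ⬝ᵥ M *ᵥ (u + K *ᵥ x) = u ⬝ᵥ u + u ⬝ᵥ (Bᵀ * P * B) *ᵥ u +
      2 * (u ⬝ᵥ (Bᵀ * P * A) *ᵥ x) + x ⬝ᵥ (Aᵀ * P * (B * M⁻¹ * Bᵀ) * P * A) *ᵥ x := by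
    have c1 : (K *ᵥ x) ⬝ᵥ M *ᵥ u = u ⬝ᵥ (Bᵀ * P * A) *ᵥ x := by
      rw [dotProduct_comm, adj, hMt, Matrix.mulVec_mulVec, hMM']
    have c2 : (K *ᵥ x) ⬝ᵥ M *ᵥ (K *ᵥ x) =
        x ⬝ᵥ (Aᵀ * P * (B * M⁻¹ * Bᵀ) * P * A) *ᵥ x := by
      rw [adj, Matrix.mulVec_mulVec, Matrix.mulVec_mulVec, Matrix.mul_assoc Kᵀ, hMM', hKt]
      simp only [Matrix.mul_assoc]
    have c3 : u ⬝ᵥ M *ᵥ u = u ⬝ᵥ u + u ⬝ᵥ (Bᵀ * P * B) *ᵥ u := by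
      rw [← hMdef, Matrix.add_mulVec, dotProduct_add, Matrix.one_mulVec]
    have c4 : u ⬝ᵥ M *ᵥ (K *ᵥ x) = u ⬝ᵥ (Bᵀ * P * A) *ᵥ x := by
      rw [Matrix.mulVec_mulVec, hMM']
    rw [Matrix.mulVec_add, add_dotProduct, dotProduct_add, dotProduct_add, c1, c2, c3, c4]
    ring
  have e2 : (A *ᵥ x + B *ᵥ u) ⬝ᵥ P *ᵥ (A *ᵥ x + B *ᵥ u) = x ⬝ᵥ (Aᵀ * P * A) *ᵥ x +
      2 * (u ⬝ᵥ (Bᵀ * P * A) *ᵥ x) + u ⬝ᵥ (Bᵀ * P * B) *ᵥ u := by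
    have c1 : (A *ᵥ x) ⬝ᵥ P *ᵥ (B *ᵥ u) = u ⬝ᵥ (Bᵀ * P * A) *ᵥ x := by
      rw [dotProduct_comm, adj, hPt, adj, Matrix.mulVec_mulVec, Matrix.mulVec_mulVec,
        Matrix.mul_assoc]
    have c2 : (B *ᵥ u) ⬝ᵥ P *ᵥ (A *ᵥ x) = u ⬝ᵥ (Bᵀ * P * A) *ᵥ x := by
      rw [adj, Matrix.mulVec_mulVec, Matrix.mulVec_mulVec, Matrix.mul_assoc]
    have c3 : (A *ᵥ x) ⬝ᵥ P *ᵥ (A *ᵥ x) = x ⬝ᵥ (Aᵀ * P * A) *ᵥ x := by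
      rw [adj, Matrix.mulVec_mulVec, Matrix.mulVec_mulVec, Matrix.mul_assoc]
    have c4 : (B *ᵥ u) ⬝ᵥ P *ᵥ (B *ᵥ u) = u ⬝ᵥ (Bᵀ * P * B) *ᵥ u := by
      rw [adj, Matrix.mulVec_mulVec, Matrix.mulVec_mulVec, Matrix.mul_assoc]
    rw [Matrix.mulVec_add, add_dotProduct, dotProduct_add, dotProduct_add, c1, c2, c3, c4]
    ring
  rw [e1, e2, Matrix.sub_mulVec, dotProduct_sub]
  ring

/-- The logarithm, up to a constant, of the density of the closed-loop path law with respect to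
the reference law on the time interval `0, …, k`. -/
def endpointPotential (Q0 Qk : Matrix (Fin n) (Fin n) ℝ) (k : ℕ)
    (x : Fin (k + 1) → EuclideanSpace ℝ (Fin n)) : ℝ :=
  1 / 2 * quadForm Q0⁻¹ (x 0) - 1 / 2 * quadForm Qk⁻¹ (x (Fin.last k))

@[fun_prop]
lemma measurable_endpointPotential (Q0 Qk : Matrix (Fin n) (Fin n) ℝ) (k : ℕ) :
    Measurable (endpointPotential Q0 Qk k) := by
  unfold endpointPotential
  fun_prop

/-- The closed-loop path law has a density with respect to the reference law that depends only
on the end points of the path. -/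
lemma exists_lintegral_pathLaw_closedLoop (hA : ∀ k < N, IsUnit (A k))
    (hQ : ∀ k ≤ N, IsUnit (QMinus A B N Sig0 SigN k) ∧
      (QMinus A B N Sig0 SigN k)ᵀ = QMinus A B N Sig0 SigN k)
    (hM : ∀ k < N, (precision A B N Sig0 SigN k).PosDef) (k : ℕ) (hk : k ≤ N) :
    ∃ c : ENNReal, ∀ f : (Fin (k + 1) → EuclideanSpace ℝ (Fin n)) → ENNReal, Measurable f →
      ∫⁻ x, f x ∂pathLaw k (AQ A B N Sig0 SigN) (BQ A B N Sig0 SigN) Sig0 =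
        c * ∫⁻ x, ENNReal.ofReal (Real.exp (endpointPotential (QMinus A B N Sig0 SigN 0)
          (QMinus A B N Sig0 SigN k) k x)) * f x ∂pathLaw k A B Sig0 := by
  induction k with
  | zero =>
    -- At horizon `0` the two laws coincide and the two halves of the potential cancel.
    refine ⟨1, fun f hf => ?_⟩
    have h : pathLaw 0 (AQ A B N Sig0 SigN) (BQ A B N Sig0 SigN) Sig0 = pathLaw 0 A B Sig0 := by
      unfold pathLaw
      congr 1
      ext1 p
      ext1 j
      rw [Subsingleton.elim (α := Fin 1) j 0, statePath_zero, statePath_zero]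
    rw [h, one_mul]
    simp [endpointPotential]
  | succ k ih =>
    have hk' : k < N := hk
    obtain ⟨c1, hc1⟩ := ih hk'.le
    obtain ⟨c2, hc2⟩ := exists_lintegral_affine_stdGaussian (hM k hk')
    refine ⟨c1 * c2, fun f hf => ?_⟩
    set Q0 := QMinus A B N Sig0 SigN 0
    set Q := QMinus A B N Sig0 SigN k with hQdef
    set Q' := QMinus A B N Sig0 SigN (k + 1) with hQ'def
    set M := precision A B N Sig0 SigN k with hMdef
    set K := M⁻¹ * (B k)ᵀ * Q'⁻¹ * A k with hK
    -- The closed loop is the original system driven by the input `M^{-1/2} w - K x`. The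
    -- reweighting is done on inputs, so no density of the state is needed and `B` may be
    -- degenerate.
    have hstep (x : EuclideanSpace ℝ (Fin n)) (w : EuclideanSpace ℝ (Fin m)) :
        Matrix.toEuclideanLin (AQ A B N Sig0 SigN k) x +
          Matrix.toEuclideanLin (BQ A B N Sig0 SigN k) w =
        Matrix.toEuclideanLin (A k) x + Matrix.toEuclideanLin (B k)
          (Matrix.toEuclideanLin (CFC.sqrt M)⁻¹ w - Matrix.toEuclideanLin K x) := by
      ext1 i
      simp only [PiLp.add_apply, Matrix.ofLp_toLpLin, Matrix.toLin'_apply, WithLp.ofLp_sub,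
        Matrix.mulVec_sub, Matrix.mulVec_mulVec, Pi.sub_apply]
      rw [AQ, BQ, hK, ← hMdef, ← hQ'def, Matrix.sub_mulVec, Pi.sub_apply]
      simp only [Matrix.mul_assoc]
      ring
    have hlogratio (x : EuclideanSpace ℝ (Fin n)) (u : EuclideanSpace ℝ (Fin m)) :
        ‖u‖ ^ 2 - quadForm M (u + Matrix.toEuclideanLin K x) = quadForm Q⁻¹ x -
          quadForm Q'⁻¹ (Matrix.toEuclideanLin (A k) x + Matrix.toEuclideanLin (B k) u) :=
      norm_sq_sub_quadForm_precision (hQ (k + 1) hk).1 (hQ (k + 1) hk).2 (hA k hk')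
        (isUnit_QMinus_succ_add (hA k hk') (hQ k hk'.le).1) (QMinus_succ_add k) (hM k hk') x u
    clear_value K M Q Q' Q0
    have hsn := measurable_snoc (E := EuclideanSpace ℝ (Fin n)) (k + 1)
    have hfs : Measurable fun p : (Fin (k + 1) → EuclideanSpace ℝ (Fin n)) ×
        EuclideanSpace ℝ (Fin m) => f (Fin.snoc (α := fun _ => EuclideanSpace ℝ (Fin n)) p.1
          (Matrix.toEuclideanLin (A k) (p.1 (Fin.last k)) + Matrix.toEuclideanLin (B k) p.2)) :=
      hf.comp (hsn.comp (measurable_fst.prodMk (by fun_prop)))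
    have hF : Measurable fun p : (Fin (k + 1) → EuclideanSpace ℝ (Fin n)) ×
        EuclideanSpace ℝ (Fin m) => ENNReal.ofReal (Real.exp (1 / 2 * ‖p.2‖ ^ 2 -
          1 / 2 * quadForm M (p.2 + Matrix.toEuclideanLin K (p.1 (Fin.last k))))) *
        f (Fin.snoc (α := fun _ => EuclideanSpace ℝ (Fin n)) p.1
          (Matrix.toEuclideanLin (A k) (p.1 (Fin.last k)) + Matrix.toEuclideanLin (B k) p.2)) :=
      Measurable.mul (by fun_prop) hfs
    rw [lintegral_pathLaw_succ k _ _ _ hf]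
    simp only [hstep]
    have hmeas : Measurable fun x => ENNReal.ofReal (Real.exp
        (endpointPotential Q0 Q' (k + 1) x)) * f x := by fun_prop
    have hfx (x : Fin (k + 1) → EuclideanSpace ℝ (Fin n)) :
        Measurable fun u : EuclideanSpace ℝ (Fin m) =>
          f (Fin.snoc (α := fun _ => EuclideanSpace ℝ (Fin n)) x
            (Matrix.toEuclideanLin (A k) (x (Fin.last k)) + Matrix.toEuclideanLin (B k) u)) := by
      have hx := hfs.comp (measurable_prodMk_left (x := x))
      exact hx
    refine (lintegral_two_step_reweight hc1 hF fun x =>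
      hc2 (Matrix.toEuclideanLin K (x (Fin.last k))) _ (hfx x)).trans ?_
    rw [lintegral_pathLaw_succ k _ _ _ hmeas]
    congr 1
    refine lintegral_congr fun x => lintegral_congr fun u => ?_
    rw [← mul_assoc, ← ENNReal.ofReal_mul (Real.exp_pos _).le, ← Real.exp_add]
    congr 3
    -- Telescoping: the term `½ x_kᵀ Q_k⁻¹ x_k` of the new step cancels the terminal term of the
    -- potential at time `k`.
    have h2 := hlogratio (x (Fin.last k)) u
    have h0 : Fin.snoc (α := fun _ => EuclideanSpace ℝ (Fin n)) x
        (Matrix.toEuclideanLin (A k) (x (Fin.last k)) + Matrix.toEuclideanLin (B k) u) 0 = x 0 :=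
      Fin.snoc_castSucc (α := fun _ => EuclideanSpace ℝ (Fin n)) _ _ 0
    simp only [endpointPotential, h0, Fin.snoc_last]
    linarith

/-- The unknown constant is fixed by total mass: testing with the function `1` shows that the
exponential has a finite integral and that the constant is its inverse. -/
lemma pathLaw_closedLoop_eq_tilted (hA : ∀ k < N, IsUnit (A k))
    (hQ : ∀ k ≤ N, IsUnit (QMinus A B N Sig0 SigN k) ∧
      (QMinus A B N Sig0 SigN k)ᵀ = QMinus A B N Sig0 SigN k)
    (hM : ∀ k < N, (precision A B N Sig0 SigN k).PosDef) :
    Integrable (fun x => Real.exp (endpointPotential (QMinus A B N Sig0 SigN 0)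
        (QMinus A B N Sig0 SigN N) N x)) (pathLaw N A B Sig0) ∧
    pathLaw N (AQ A B N Sig0 SigN) (BQ A B N Sig0 SigN) Sig0 =
      (pathLaw N A B Sig0).tilted (endpointPotential (QMinus A B N Sig0 SigN 0)
        (QMinus A B N Sig0 SigN N) N) := by
  obtain ⟨c, hc⟩ := exists_lintegral_pathLaw_closedLoop hA hQ hM N le_rfl
  set f := endpointPotential (QMinus A B N Sig0 SigN 0) (QMinus A B N Sig0 SigN N) N with hf
  have hfm : Measurable f := measurable_endpointPotential _ _ _
  have h1 := hc 1 measurable_one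
  simp only [Pi.one_apply, lintegral_one, measure_univ, mul_one] at h1
  have hci := ENNReal.eq_inv_of_mul_eq_one_left h1.symm
  have htop : ∫⁻ x, ENNReal.ofReal (Real.exp (f x)) ∂pathLaw N A B Sig0 ≠ ⊤ := by
    intro h
    rw [h, ENNReal.inv_top] at hci
    rw [hci, zero_mul] at h1
    exact one_ne_zero h1
  have hint : Integrable (fun x => Real.exp (f x)) (pathLaw N A B Sig0) := by
    refine ⟨by fun_prop, ?_⟩
    rw [hasFiniteIntegral_iff_ofReal (Filter.Eventually.of_forall fun _ => (Real.exp_pos _).le)]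
    exact lt_top_iff_ne_top.2 htop
  refine ⟨hint, ?_⟩
  refine Measure.ext_of_lintegral _ fun g hg => ?_
  have hZ : ENNReal.ofReal (∫ x, Real.exp (f x) ∂pathLaw N A B Sig0) =
      ∫⁻ x, ENNReal.ofReal (Real.exp (f x)) ∂pathLaw N A B Sig0 :=
    ofReal_integral_eq_lintegral_ofReal hint
      (Filter.Eventually.of_forall fun _ => (Real.exp_pos _).le)
  rw [hc g hg, Measure.tilted, lintegral_withDensity_eq_lintegral_mul _ (by fun_prop) hg,
    ← lintegral_const_mul _ (by fun_prop)]
  refine lintegral_congr fun x => ?_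
  simp only [Pi.mul_apply]
  rw [ENNReal.ofReal_div_of_pos (integral_exp_pos hint), hZ, hci, ENNReal.div_eq_inv_mul, mul_assoc]

end Tilt

/-! ### Endpoint integrals and the conclusion -/

lemma endpointPotential_integral {n N : ℕ} {Sig0 SigN : Matrix (Fin n) (Fin n) ℝ}
    (Q0 QN : Matrix (Fin n) (Fin n) ℝ) {P : Measure (Fin (N + 1) → EuclideanSpace ℝ (Fin n))}
    (hP : HasEndMarginals Sig0 SigN P) :
    Integrable (endpointPotential Q0 QN N) P ∧ ∫ x, endpointPotential Q0 QN N x ∂P =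
      1 / 2 * ∫ x, quadForm Q0⁻¹ x ∂multivariateGaussian 0 Sig0 -
        1 / 2 * ∫ x, quadForm QN⁻¹ x ∂multivariateGaussian 0 SigN := by
  have i0 : Integrable (fun x => quadForm Q0⁻¹ (x 0)) P := by
    have h := integrable_quadForm Q0⁻¹ (multivariateGaussian 0 Sig0)
    rw [← hP.map_zero] at h
    exact h.comp_measurable (by fun_prop)
  have iN : Integrable (fun x => quadForm QN⁻¹ (x (Fin.last N))) P := by
    have h := integrable_quadForm QN⁻¹ (multivariateGaussian 0 SigN)
    rw [← hP.map_last] at h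
    exact h.comp_measurable (by fun_prop)
  have h0 := integral_map (μ := P) (φ := fun x : Fin (N + 1) → EuclideanSpace ℝ (Fin n) => x 0)
    (measurable_pi_apply _).aemeasurable (measurable_quadForm Q0⁻¹).aestronglyMeasurable
  have hN := integral_map (μ := P)
    (φ := fun x : Fin (N + 1) → EuclideanSpace ℝ (Fin n) => x (Fin.last N))
    (measurable_pi_apply _).aemeasurable (measurable_quadForm QN⁻¹).aestronglyMeasurable
  refine ⟨(i0.const_mul _).sub (iN.const_mul _), ?_⟩
  simp only [endpointPotential]
  rw [integral_sub (i0.const_mul _) (iN.const_mul _), integral_const_mul, integral_const_mul,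
    ← hP.map_zero, ← hP.map_last, h0, hN]

end

theorem theorem3 (n m N : ℕ)
    (A : ℕ → Matrix (Fin n) (Fin n) ℝ) (B : ℕ → Matrix (Fin n) (Fin m) ℝ)
    (Sig0 SigN : Matrix (Fin n) (Fin n) ℝ)
    (hSig0 : Sig0.PosDef) (hSigN : SigN.PosDef)
    (hA : ∀ k < N, IsUnit (A k))
    (hG : ∃ kr : ℕ, 1 ≤ kr ∧ kr ≤ N ∧
      (∀ k : ℕ, kr ≤ k → k ≤ N → IsUnit (reachGramian A B k 0)) ∧
      (∀ k : ℕ, k < kr → IsUnit (reachGramian A B N k)))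
    (hF : IsUnit (forwardMat (normCovInit A B N Sig0) (normCovTerm A B N SigN)))
    (hB : IsUnit (backwardMat (normCovInit A B N Sig0) (normCovTerm A B N SigN))) :
    IsSchrodingerBridge (pathLaw N A B Sig0) Sig0 SigN
        (pathLaw N (AQ A B N Sig0 SigN) (BQ A B N Sig0 SigN) Sig0) ∧
      ∀ P : Measure (Fin (N + 1) → EuclideanSpace ℝ (Fin n)),
        IsSchrodingerBridge (pathLaw N A B Sig0) Sig0 SigN P →
          P = pathLaw N (AQ A B N Sig0 SigN) (BQ A B N Sig0 SigN) Sig0 := by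
  obtain ⟨kr, hkr, -, -, hkr'⟩ := hG
  -- As `kr ≥ 1`, the time `0` lies in the range where `G_r(N, k)` is invertible.
  have hGc : (ctrlGramian A B N 0).PosDef := posDef_ctrlGramian hA (hkr' 0 hkr)
  obtain ⟨hQ, hM⟩ := QMinus_properties hSig0 hSigN hA hGc hF
  obtain ⟨hint, htilt⟩ := pathLaw_closedLoop_eq_tilted hA hQ hM
  have hmarg : HasEndMarginals Sig0 SigN
      (pathLaw N (AQ A B N Sig0 SigN) (BQ A B N Sig0 SigN) Sig0) := by
    refine ⟨inferInstance, map_zero_pathLaw N _ _ _, ?_⟩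
    rw [map_last_pathLaw _ _ hSig0.posSemidef, closedLoopCov_terminal hSig0 hSigN hA hGc hF]
  set R := pathLaw N A B Sig0
  set S := pathLaw N (AQ A B N Sig0 SigN) (BQ A B N Sig0 SigN) Sig0
  set f := endpointPotential (QMinus A B N Sig0 SigN 0) (QMinus A B N Sig0 SigN N) N
  have hSf := endpointPotential_integral (QMinus A B N Sig0 SigN 0) (QMinus A B N Sig0 SigN N) hmarg
  -- `P` and `S` share their end marginals, hence the integral of the potential, which is what the
  -- splitting of the divergence requires.
  have key : ∀ P, HasEndMarginals Sig0 SigN P → klDiv P R ≠ ⊤ →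
      klDiv S R ≠ ⊤ ∧ klDiv P R = klDiv P S + klDiv S R := by
    intro P hP htop
    have := hP.isProbabilityMeasure
    have hPf := endpointPotential_integral (QMinus A B N Sig0 SigN 0)
      (QMinus A B N Sig0 SigN N) hP
    have hSf' := hSf
    rw [htilt] at hSf' ⊢
    exact klDiv_eq_klDiv_tilted_add hint hSf'.1 hPf.1 (hPf.2.trans hSf'.2.symm) htop
  -- Finiteness is shown separately: it makes the divergence of any minimizer finite and permits
  -- cancelling `klDiv S R` in the uniqueness part.
  have hfin : klDiv S R ≠ ⊤ := by
    have hSR : S ≪ R := by rw [htilt]; exact tilted_absolutelyContinuous R f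
    refine klDiv_ne_top hSR ?_
    have hllr := hSR.ae_le (log_rnDeriv_tilted_left_self hint)
    rw [← htilt] at hllr
    exact (integrable_congr hllr).2 (hSf.1.sub (integrable_const _))
  refine ⟨⟨hmarg, fun P hP => ?_⟩, fun P hP => ?_⟩
  · by_cases htop : klDiv P R = ⊤
    · rw [htop]; exact le_top
    · rw [(key P hP htop).2]; exact le_add_self
  · have hle := hP.2 S hmarg
    have htop : klDiv P R ≠ ⊤ := (hle.trans_lt (lt_top_iff_ne_top.2 hfin)).ne
    have := hP.1.isProbabilityMeasure
    rw [(key P hP.1 htop).2] at hle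
    have h0 : klDiv P S = 0 := by
      have h : klDiv P S + klDiv S R ≤ 0 + klDiv S R := by rwa [zero_add]
      exact nonpos_iff_eq_zero.1 ((ENNReal.add_le_add_iff_right hfin).1 h)
    exact klDiv_eq_zero_iff.1 h0
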